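/- Let $R$ be a commutative ring and $n\ge 3$ an integer. Put $\Theta_{hb}=\{1,\dots,n,-n,\dots,-1\}$ and $\Theta=\Theta_{hb}\cup\{0\}$, and index the rows and columns of $(2n+1)\times(2n+1)$ matrices over $R$, and the coordinates of vectors $u\in R^{2n+1}$, by $\Theta$. Let $Q(u)=u_1u_{-1}+\dots+u_nu_{-n}+u_0^2$ and $$O_{2n+1}(R)=\{\sigma\in GL_{2n+1}(R)\mid Q(\sigma u)=Q(u)\ \text{for all } u\in R^{2n+1}\}.$$ Let $e$ be the identity matrix and $e^{ij}$ the matrix units. For $x\in R$ and $i,j\in\Theta_{hb}$ with $i\neq\pm j$ put $T_{ij}(x)=e+xe^{ij}-xe^{-j,-i}$, and for $x\in R$ and $i\in\Theta_{hb}$ put $T_i(x)=e+xe^{0,-i}-2xe^{i0}-x^2e^{i,-i}$; these are elements of $O_{2n+1}(R)$. Let $EO_{2n+1}(R)$ be the subgroup of $O_{2n+1}(R)$ generated by all $T_{ij}(x)$ and all $T_i(x)$. An admissible pair is a pair $(I,J)$ of ideals of $R$ such that $I\subseteq J$, and $2x\in I$ and $x^2\in I$ for all $x\in J$. For an admissible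 pair $(I,J)$ define the following subgroups of $O_{2n+1}(R)$. - $EO_{2n+1}(I,J)$ is the subgroup generated by all $T_{ij}(x)$ with $x\in I$ and all $T_i(x)$ with $x\in J$, and $EO_{2n+1}(R,I,J)$ is the normal closure of $EO_{2n+1}(I,J)$ in $EO_{2n+1}(R)$. - $O_{2n+1}(R,I,J)$ consists of all $\sigma\in O_{2n+1}(R)$ with $\sigma_{ij}-\delta_{ij}\in I$ for all $i\in\Theta_{hb}$, $j\in\Theta$, and $\sigma_{0j}-\delta_{0j}\in J$ for all $j\in\Theta$. - $CO_{2n+1}(R,I,J)$ consists of all $\sigma\in O_{2n+1}(R)$ with $\sigma\varepsilon\sigma^{-1}\varepsilon^{-1}\in O_{2n+1}(R,I,J)$ for all $\varepsilon\in EO_{2n+1}(R)$. **Corollary (Sandwich Classification for $O_{2n+1}(R)$).** Let $H$ be a subgroup of $O_{2n+1}(R)$. Then $H$ is normalized by $EO_{2n+1}(R)$ if and only if $$EO_{2n+1}(R,I,J)\subseteq H\subseteq CO_{2n+1}(R,I,J)$$ for some admissible pair $(I,J)$. -/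

import Mathlib

open scoped Matrix

noncomputable section

namespace OddOrthogonal

/-- The index set `Θ_hb = {1, …, n, -n, …, -1}`: `inl k` stands for the index `k + 1` and `inr k`
for the index `-(k + 1)`, so that `i ↦ -i` is `Sum.swap`. -/
abbrev Hb (n : ℕ) : Type := Fin n ⊕ Fin n

/-- The index set `Θ = {0} ∪ Θ_hb`. -/
abbrev Theta (n : ℕ) : Type := Unit ⊕ Hb n

/-- The index `0` of `Θ`. -/
abbrev zero {n : ℕ} : Theta n := Sum.inl ()

/-- The inclusion of `Θ_hb` into `Θ`. -/
abbrev hb {n : ℕ} (i : Hb n) : Theta n := Sum.inr i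

/-- The quadratic form `Q(u) = u₁u₋₁ + … + uₙu₋ₙ + u₀²`. -/
def Q {n : ℕ} {R : Type*} [CommRing R] (u : Theta n → R) : R :=
  ∑ k : Fin n, u (hb (Sum.inl k)) * u (hb (Sum.inr k)) + u zero ^ 2

/-- The odd-dimensional orthogonal group `O_{2n+1}(R)`. -/
def orthogonal (n : ℕ) (R : Type*) [CommRing R] : Subgroup (GL (Theta n) R) where
  carrier := {σ | ∀ u : Theta n → R, Q (σ.1 *ᵥ u) = Q u}
  one_mem' := by
    intro u
    simp
  mul_mem' := by
    intro σ τ hσ hτ u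
    have h : (σ * τ).1 *ᵥ u = σ.1 *ᵥ (τ.1 *ᵥ u) := by
      simp [Matrix.mulVec_mulVec]
    rw [h, hσ, hτ]
  inv_mem' := by
    intro σ hσ u
    have h := hσ ((σ⁻¹).1 *ᵥ u)
    have h2 : σ.1 *ᵥ ((σ⁻¹).1 *ᵥ u) = u := by
      rw [Matrix.mulVec_mulVec, Units.mul_inv, Matrix.one_mulVec]
    rw [h2] at h
    exact h.symm

/-! ### Auxiliary facts on the quadratic form -/

theorem swap_ne {n : ℕ} (i : Hb n) : i.swap ≠ i := by
  cases i <;> simp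

theorem ne_swap {n : ℕ} (i : Hb n) : i ≠ i.swap := (swap_ne i).symm

/-- The bilinear form associated with `Q`. -/
def polarForm {n : ℕ} {R : Type*} [CommRing R] (u v : Theta n → R) : R :=
  ∑ i : Hb n, u (hb i) * v (hb i.swap) + 2 * (u zero * v zero)

theorem Q_add {n : ℕ} {R : Type*} [CommRing R] (u v : Theta n → R) :
    Q (u + v) = Q u + Q v + polarForm u v := by
  simp only [Q, polarForm, Pi.add_apply, Fintype.sum_sum_type, Sum.swap_inl, Sum.swap_inr,
    add_mul, mul_add, Finset.sum_add_distrib]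
  simp only [mul_comm (u (hb (Sum.inr _)))]
  ring

theorem polarForm_single_hb {n : ℕ} {R : Type*} [CommRing R] (u : Theta n → R) (i : Hb n)
    (a : R) : polarForm u (Pi.single (hb i) a) = u (hb i.swap) * a := by
  unfold polarForm
  rw [Finset.sum_eq_single i.swap]
  · simp
  · intro j _ hj
    have : j.swap ≠ i := by
      rintro rfl
      simp at hj
    simp [this]
  · simp

theorem polarForm_single_zero {n : ℕ} {R : Type*} [CommRing R] (u : Theta n → R) (a : R) :
    polarForm u (Pi.single zero a) = 2 * (u zero * a) := by
  simp [polarForm]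

theorem Q_single_hb {n : ℕ} {R : Type*} [CommRing R] (i : Hb n) (a : R) :
    Q (Pi.single (hb i) a) = 0 := by
  have h : ∀ k : Fin n, (Pi.single (hb i) a : Theta n → R) (hb (Sum.inl k)) *
      (Pi.single (hb i) a : Theta n → R) (hb (Sum.inr k)) = 0 := by
    intro k
    cases i <;> simp [Pi.single_apply]
  simp [Q, h]

theorem Q_single_zero {n : ℕ} {R : Type*} [CommRing R] (a : R) :
    Q (Pi.single (zero : Theta n) a) = a ^ 2 := by
  simp [Q]

/-! ### Elementary matrices -/

/-- The matrix `e + x e^{ij} - x e^{-j,-i}`. -/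
def shortRootMatrix {n : ℕ} {R : Type*} [CommRing R] (i j : Hb n) (x : R) :
    Matrix (Theta n) (Theta n) R :=
  1 + Matrix.single (hb i) (hb j) x - Matrix.single (hb j.swap) (hb i.swap) x

/-- The matrix `e + x e^{0,-i} - 2x e^{i0} - x² e^{i,-i}`. -/
def extraShortRootMatrix {n : ℕ} {R : Type*} [CommRing R] (i : Hb n) (x : R) :
    Matrix (Theta n) (Theta n) R :=
  1 + Matrix.single zero (hb i.swap) x - Matrix.single (hb i) zero (2 * x)
    - Matrix.single (hb i) (hb i.swap) (x ^ 2)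

theorem shortRootMatrix_mul_neg {n : ℕ} {R : Type*} [CommRing R] {i j : Hb n}
    (hij : i ≠ j ∧ i ≠ j.swap) (x : R) :
    shortRootMatrix i j x * shortRootMatrix i j (-x) = 1 := by
  have h1 : (hb j : Theta n) ≠ hb i := by simpa using hij.1.symm
  have h2 : (hb j : Theta n) ≠ hb j.swap := by simpa using ne_swap j
  have h3 : (hb i.swap : Theta n) ≠ hb i := by simpa using swap_ne i
  have h4 : (hb i.swap : Theta n) ≠ hb j.swap := by
    intro h
    exact hij.1 (Sum.swap_leftInverse.injective (Sum.inr_injective h))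
  simp only [shortRootMatrix, mul_add, mul_sub, add_mul, sub_mul, one_mul, mul_one,
    Matrix.single_mul_single_of_ne _ _ _ _ h1, Matrix.single_mul_single_of_ne _ _ _ _ h2,
    Matrix.single_mul_single_of_ne _ _ _ _ h3, Matrix.single_mul_single_of_ne _ _ _ _ h4,
    ← Matrix.single_neg, mul_neg]
  abel

theorem extraShortRootMatrix_mul_neg {n : ℕ} {R : Type*} [CommRing R] (i : Hb n) (x : R) :
    extraShortRootMatrix i x * extraShortRootMatrix i (-x) = 1 := by
  have h1 : (hb i.swap : Theta n) ≠ zero := by simp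
  have h2 : (hb i.swap : Theta n) ≠ hb i := by simpa using swap_ne i
  have h3 : (zero : Theta n) ≠ hb i := by simp
  have h4 : 2 * x * x = x ^ 2 + x ^ 2 := by ring
  simp only [extraShortRootMatrix, mul_add, mul_sub, add_mul, sub_mul, one_mul, mul_one,
    Matrix.single_mul_single_of_ne _ _ _ _ h1, Matrix.single_mul_single_of_ne _ _ _ _ h2,
    Matrix.single_mul_single_of_ne _ _ _ _ h3, Matrix.single_mul_single_same, h4, Matrix.single_add,
    mul_neg, neg_sq, ← Matrix.single_neg]
  abel

theorem Q_shortRootMatrix_mulVec {n : ℕ} {R : Type*} [CommRing R] {i j : Hb n}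
    (hij : i ≠ j ∧ i ≠ j.swap) (x : R) (u : Theta n → R) :
    Q (shortRootMatrix i j x *ᵥ u) = Q u := by
  have h : shortRootMatrix i j x *ᵥ u =
      u + Pi.single (hb i) (x * u (hb j)) + Pi.single (hb j.swap) (-(x * u (hb i.swap))) := by
    simp only [shortRootMatrix, Matrix.add_mulVec, Matrix.sub_mulVec, Matrix.one_mulVec,
      Matrix.single_mulVec, Pi.single_neg]
    rw [sub_eq_add_neg]
    rfl
  have h1 : (hb j : Theta n) ≠ hb i := by simpa using hij.1.symm
  rw [h, Q_add, Q_add, Q_single_hb, Q_single_hb, polarForm_single_hb, polarForm_single_hb]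
  simp only [Sum.swap_swap, Pi.add_apply, Pi.single_eq_of_ne h1]
  ring

theorem Q_extraShortRootMatrix_mulVec {n : ℕ} {R : Type*} [CommRing R] (i : Hb n) (x : R)
    (u : Theta n → R) : Q (extraShortRootMatrix i x *ᵥ u) = Q u := by
  have h : extraShortRootMatrix i x *ᵥ u =
      u + (Pi.single zero (x * u (hb i.swap)) : Theta n → R) +
        (Pi.single (hb i) (-(2 * x * u zero + x ^ 2 * u (hb i.swap))) : Theta n → R) := by
    simp only [extraShortRootMatrix, Matrix.add_mulVec, Matrix.sub_mulVec, Matrix.one_mulVec,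
      Matrix.single_mulVec, Pi.single_neg, Pi.single_add]
    rw [sub_sub, sub_eq_add_neg]
    rfl
  have h1 : (hb i.swap : Theta n) ≠ zero := by simp
  rw [h, Q_add, Q_add, Q_single_hb, Q_single_zero, polarForm_single_hb, polarForm_single_zero]
  simp only [Pi.add_apply, Pi.single_eq_of_ne h1]
  ring

/-- The short root matrix `T_{ij}(x)`, `i ≠ ±j`, as an element of `O_{2n+1}(R)`. -/
def shortRoot {n : ℕ} {R : Type*} [CommRing R] (i j : Hb n) (hij : i ≠ j ∧ i ≠ j.swap) (x : R) :
    orthogonal n R :=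
  ⟨⟨shortRootMatrix i j x, shortRootMatrix i j (-x), shortRootMatrix_mul_neg hij x,
      by simpa using shortRootMatrix_mul_neg hij (-x)⟩,
    Q_shortRootMatrix_mulVec hij x⟩

/-- The extra short root matrix `T_i(x)` as an element of `O_{2n+1}(R)`. -/
def extraShortRoot {n : ℕ} {R : Type*} [CommRing R] (i : Hb n) (x : R) : orthogonal n R :=
  ⟨⟨extraShortRootMatrix i x, extraShortRootMatrix i (-x), extraShortRootMatrix_mul_neg i x,
      by simpa using extraShortRootMatrix_mul_neg i (-x)⟩,
    Q_extraShortRootMatrix_mulVec i x⟩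

/-- The elementary subgroup `EO_{2n+1}(R)`. -/
def elementary (n : ℕ) (R : Type*) [CommRing R] : Subgroup (orthogonal n R) :=
  Subgroup.closure
    ({σ | ∃ (i j : Hb n) (hij : i ≠ j ∧ i ≠ j.swap) (x : R), σ = shortRoot i j hij x} ∪
      {σ | ∃ (i : Hb n) (x : R), σ = extraShortRoot i x})

/-! ### Relative elementary subgroups -/

/-- An admissible pair: ideals `I`, `J` of `R` with `2J, {x² ∣ x ∈ J} ⊆ I ⊆ J`. -/
structure AdmissiblePair (R : Type*) [CommRing R] where
  I : Ideal R
  J : Ideal R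
  two_mul_mem : ∀ x ∈ J, 2 * x ∈ I
  sq_mem : ∀ x ∈ J, x ^ 2 ∈ I
  le : I ≤ J

/-- The preelementary subgroup `EO_{2n+1}(I,J)`. -/
def preElementary (n : ℕ) {R : Type*} [CommRing R] (P : AdmissiblePair R) :
    Subgroup (orthogonal n R) :=
  Subgroup.closure
    ({σ | ∃ (i j : Hb n) (hij : i ≠ j ∧ i ≠ j.swap), ∃ x ∈ P.I, σ = shortRoot i j hij x} ∪
      {σ | ∃ (i : Hb n), ∃ x ∈ P.J, σ = extraShortRoot i x})

theorem preElementary_le_elementary (n : ℕ) {R : Type*} [CommRing R] (P : AdmissiblePair R) :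
    preElementary n P ≤ elementary n R := by
  refine Subgroup.closure_mono (Set.union_subset_union ?_ ?_)
  · rintro σ ⟨i, j, hij, x, -, rfl⟩
    exact ⟨i, j, hij, x, rfl⟩
  · rintro σ ⟨i, x, -, rfl⟩
    exact ⟨i, x, rfl⟩

/-- The elementary subgroup `EO_{2n+1}(R,I,J)` of level `(I,J)`: the normal closure of
`EO_{2n+1}(I,J)` in `EO_{2n+1}(R)`, regarded as a subgroup of `O_{2n+1}(R)`. -/
def relElementary (n : ℕ) {R : Type*} [CommRing R] (P : AdmissiblePair R) :
    Subgroup (orthogonal n R) :=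
  (Subgroup.normalClosure
    ((preElementary n P).subgroupOf (elementary n R) : Set (elementary n R))).map
      (elementary n R).subtype

/-! ### Congruence subgroups -/

/-- The matrices whose rows with index in `Θ_hb` have entries in `I`, and whose row with index `0`
has entries in `J`. -/
def IsSmall {n : ℕ} {R : Type*} [CommRing R] (P : AdmissiblePair R)
    (A : Matrix (Theta n) (Theta n) R) : Prop :=
  (∀ (i : Hb n) (j : Theta n), A (hb i) j ∈ P.I) ∧ ∀ j : Theta n, A zero j ∈ P.J

theorem IsSmall.add {n : ℕ} {R : Type*} [CommRing R] {P : AdmissiblePair R}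
    {A B : Matrix (Theta n) (Theta n) R} (hA : IsSmall P A) (hB : IsSmall P B) :
    IsSmall P (A + B) :=
  ⟨fun i j => P.I.add_mem (hA.1 i j) (hB.1 i j), fun j => P.J.add_mem (hA.2 j) (hB.2 j)⟩

theorem IsSmall.neg {n : ℕ} {R : Type*} [CommRing R] {P : AdmissiblePair R}
    {A : Matrix (Theta n) (Theta n) R} (hA : IsSmall P A) : IsSmall P (-A) :=
  ⟨fun i j => P.I.neg_mem (hA.1 i j), fun j => P.J.neg_mem (hA.2 j)⟩

theorem IsSmall.mul_right {n : ℕ} {R : Type*} [CommRing R] {P : AdmissiblePair R}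
    {A : Matrix (Theta n) (Theta n) R} (hA : IsSmall P A) (B : Matrix (Theta n) (Theta n) R) :
    IsSmall P (A * B) := by
  refine ⟨fun i j => ?_, fun j => ?_⟩
  · rw [Matrix.mul_apply]
    exact P.I.sum_mem fun k _ => P.I.mul_mem_right _ (hA.1 i k)
  · rw [Matrix.mul_apply]
    exact P.J.sum_mem fun k _ => P.J.mul_mem_right _ (hA.2 k)

/-- The principal congruence subgroup `O_{2n+1}(R,I,J)`. -/
def principalCongruence (n : ℕ) {R : Type*} [CommRing R] (P : AdmissiblePair R) :
    Subgroup (orthogonal n R) where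
  carrier := {σ | IsSmall P (σ.1.1 - 1)}
  one_mem' := by
    simp [IsSmall]
  mul_mem' := by
    intro σ τ hσ hτ
    have h : (σ * τ).1.1 - 1 = (σ.1.1 - 1) * τ.1.1 + (τ.1.1 - 1) := by
      simp [sub_mul]
    change IsSmall P _
    rw [h]
    exact (hσ.mul_right _).add hτ
  inv_mem' := by
    intro σ hσ
    have h : (σ⁻¹).1.1 - 1 = -((σ.1.1 - 1) * (σ⁻¹).1.1) := by
      have h2 : σ.1.1 * (σ⁻¹).1.1 = 1 := Units.mul_inv σ.1
      rw [sub_mul, h2, one_mul, neg_sub]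
    change IsSmall P _
    rw [h]
    exact (hσ.mul_right _).neg

theorem mem_principalCongruence {n : ℕ} {R : Type*} [CommRing R] {P : AdmissiblePair R}
    {σ : orthogonal n R} : σ ∈ principalCongruence n P ↔
      (∀ (i : Hb n) (j : Theta n), σ.1.1 (hb i) j - (if hb i = j then 1 else 0) ∈ P.I) ∧
        ∀ j : Theta n, σ.1.1 zero j - (if zero = j then 1 else 0) ∈ P.J :=
  Iff.rfl

theorem apply_zero_eq {n : ℕ} {R : Type*} [CommRing R] (g : orthogonal n R) (i : Hb n) :
    g.1.1 (hb i) zero = 2 * (g⁻¹).1.1 zero (hb i.swap) := by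
  have hg : ∀ u : Theta n → R, Q (g.1.1 *ᵥ u) = Q u := g.2
  have h1 : g.1.1 *ᵥ ((g⁻¹).1.1 *ᵥ Pi.single (hb i.swap) 1) = Pi.single (hb i.swap) 1 := by
    have h2 : g.1.1 * (g⁻¹).1.1 = 1 := Units.mul_inv g.1
    rw [Matrix.mulVec_mulVec, h2, Matrix.one_mulVec]
  have h3 := hg ((g⁻¹).1.1 *ᵥ Pi.single (hb i.swap) 1 + Pi.single zero 1)
  have h4 := hg ((g⁻¹).1.1 *ᵥ Pi.single (hb i.swap) 1)
  have h5 := hg (Pi.single zero 1)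
  rw [h1] at h4
  rw [Matrix.mulVec_add, h1, add_comm, Q_add, Q_add, polarForm_single_hb, polarForm_single_zero,
    h5, h4] at h3
  simp only [Sum.swap_swap, Matrix.mulVec_single_one, Matrix.col_apply] at h3
  linear_combination h3

theorem IsSmall.mul_left {n : ℕ} {R : Type*} [CommRing R] {P : AdmissiblePair R}
    {A : Matrix (Theta n) (Theta n) R} (hA : IsSmall P A) (g : orthogonal n R) :
    IsSmall P (g.1.1 * A) := by
  refine ⟨fun i j => ?_, fun j => ?_⟩
  · rw [Matrix.mul_apply]
    refine P.I.sum_mem fun k _ => ?_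
    rcases k with ⟨⟩ | k
    · have h : g.1.1 (hb i) zero * A zero j =
          (g⁻¹).1.1 zero (hb i.swap) * (2 * A zero j) := by
        rw [apply_zero_eq]
        ring
      exact h ▸ P.I.mul_mem_left _ (P.two_mul_mem _ (hA.2 j))
    · exact P.I.mul_mem_left _ (hA.1 k j)
  · rw [Matrix.mul_apply]
    refine P.J.sum_mem fun k _ => ?_
    rcases k with ⟨⟩ | k
    · exact P.J.mul_mem_left _ (hA.2 j)
    · exact P.J.mul_mem_left _ (P.le (hA.1 k j))

instance principalCongruence_normal (n : ℕ) {R : Type*} [CommRing R] (P : AdmissiblePair R) :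
    (principalCongruence n P).Normal where
  conj_mem := by
    intro σ hσ g
    have h : (g * σ * g⁻¹).1.1 - 1 = g.1.1 * (σ.1.1 - 1) * (g⁻¹).1.1 := by
      have h2 : g.1.1 * (g⁻¹).1.1 = 1 := Units.mul_inv g.1
      rw [mul_sub, sub_mul, mul_one, h2]
      rfl
    change IsSmall P _
    rw [h]
    exact (IsSmall.mul_left hσ g).mul_right _

/-- The full congruence subgroup `CO_{2n+1}(R,I,J)`:
all `σ` in `O_{2n+1}(R)` with `[σ, EO_{2n+1}(R)] ⊆ O_{2n+1}(R,I,J)`. -/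
def fullCongruence (n : ℕ) {R : Type*} [CommRing R] (P : AdmissiblePair R) :
    Subgroup (orthogonal n R) where
  carrier := {σ | ∀ ε ∈ elementary n R, σ * ε * σ⁻¹ * ε⁻¹ ∈ principalCongruence n P}
  one_mem' := by
    intro ε _
    simp
  mul_mem' := by
    intro σ τ hσ hτ ε hε
    have h : (σ * τ) * ε * (σ * τ)⁻¹ * ε⁻¹ =
        σ * (τ * ε * τ⁻¹ * ε⁻¹) * σ⁻¹ * (σ * ε * σ⁻¹ * ε⁻¹) := by
      group
    rw [h]
    exact mul_mem ((principalCongruence_normal n P).conj_mem _ (hτ ε hε) σ) (hσ ε hε)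
  inv_mem' := by
    intro σ hσ ε hε
    have h : σ⁻¹ * ε * σ⁻¹⁻¹ * ε⁻¹ = σ⁻¹ * (σ * ε * σ⁻¹ * ε⁻¹)⁻¹ * σ⁻¹⁻¹ := by
      group
    rw [h]
    exact (principalCongruence_normal n P).conj_mem _ (inv_mem (hσ ε hε)) σ⁻¹

end OddOrthogonal

end

/-!
The proof works with Siegel transformations
`siegel u v : w ↦ w + B(v,w) u - B(u,w) v - Q(v) B(u,w) u`, where `B` is the polar form of `Q`, the
vector `u` is isotropic and `v` is orthogonal to `u`. The generators of `EO_{2n+1}(R)` are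
`T_{ij}(x) = siegel e_i (x e_{-j})` and `T_i(x) = siegel e_i (-x e_0)`, conjugation by an isometry
`g` turns `siegel u v` into `siegel (g u) (g v)`, and `siegel u v` is additive in `v`. Consequently,
if `g` fixes `u`, then the commutator of `g` and `siegel u v` is `siegel u (g v - v)`. Nearly all
computations use only these rules and the symmetry `siegel u v = siegel v (-u)` for two isotropic
vectors.

*Subgroups between `EO(R,I,J)` and `CO(R,I,J)` are normalized by `EO(R)`.* What is needed is
`[CO(R,I,J), EO(R)] ≤ EO(R,I,J)`. The main step is the standard commutator formula
`[O(R,I,J), EO(R)] ≤ EO(R,I,J)` (`IsAbove.commutator_principalCongruence_mem`). A conjugate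
`σ T_{ij}(x) σ⁻¹` is a Siegel transformation along the column `u = σ e_i`, so the question is for
which `v` the transformation `siegel u v` lies in `EO(R,I,J)`. For fixed `u` these `v` form an
additive group; after multiplication by a power of a coordinate `u_l` it contains all vectors `v`
orthogonal to `u` with coordinates in `(I, J)`, because `u_l² v` is modulo `R u` a combination of
the vectors `u_l e_k - u_{-k} e_{-l}` and `u_l e_0 - 2 u_0 e_{-l}`. Since the coordinates of a
column generate the unit ideal, so do their powers, and `siegel u v` lies in `EO(R,I,J)` for all
these `v` (`IsAbove.mem_siegelSub_of_unimodular`). This reduces `σ T_{ij}(x) σ⁻¹` to an explicit product,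
which is compared with `T_{ij}(x)` modulo `EO(R,I,J)`. For the admissible pair `(R, R)` the
formula says that `EO(R)` is normal in `O(R)`; as `EO(R)` is generated by commutators, the inclusion for
`CO(R,I,J)` follows (`IsAbove.commutator_fullCongruence_mem`).

*Subgroups normalized by `EO(R)`.* For such a subgroup `H` let `I` be the set of all `x` such that
every `T_{ij}(x)` lies in `H`, and `J` the set of all `x` such that every `T_i(x)` lies in `H`. The
commutator relations show that `(I, J)` is an admissible pair, and `EO(R,I,J) ≤ H` is clear. To see
that `σ ∈ H` lies in `CO(R,I,J)`, take for indices `i, b, c` the element `τ` of `EO(R)` which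
corresponds to the contraction of `e_{-i} ∧ e_b ∧ e_c` with `u = σ e_i`; it fixes `u`
(`act_stabilizing_self`). Then `σ⁻¹ τ σ` fixes `e_i`, and `σ⁻¹ τ σ τ⁻¹` lies in `H`. Conjugating a
transformation along `e_i` by it shows that the conjugates by `τ` of transformations along `e_i`
commute modulo `H` with the transformations along `e_i` (`IsENormal.commutator_siegel_mem`). One
such commutator is `T_{i,-c}(σ_{-b,i})`, so the coefficients `σ_{ji}` with `j ≠ ±i` belong to `I`.
Applying this to conjugates of `σ` by elementary matrices yields the remaining congruences modulo
`I`, and a further use of `τ` yields `σ_{0c} ∈ J` (`IsENormal.coeff_row_zero_inv_mem`). Altogether `σ` is a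
scalar matrix up to a small matrix, and therefore lies in `CO(R,I,J)`.
-/

namespace OddOrthogonal

variable {n : ℕ} {R : Type*} [CommRing R]

/-! ### Indices -/

/-- The indices `i` and `j` satisfy `i ≠ ±j`. -/
def Apart (i j : Hb n) : Prop := i ≠ j ∧ i ≠ j.swap

theorem Apart.symm {i j : Hb n} (h : Apart i j) : Apart j i :=
  ⟨h.1.symm, fun h' => h.2 (by rw [h', Sum.swap_swap])⟩

theorem Apart.swap_right {i j : Hb n} (h : Apart i j) : Apart i j.swap :=
  ⟨h.2, by rw [Sum.swap_swap]; exact h.1⟩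

theorem Apart.swap_left {i j : Hb n} (h : Apart i j) : Apart i.swap j :=
  h.symm.swap_right.symm

theorem apart_iff {i j : Hb n} : Apart i j ↔ Sum.elim id id i ≠ Sum.elim id id j := by
  rcases i with i | i <;> rcases j with j | j <;> simp [Apart]

theorem exists_apart (hn : 3 ≤ n) (i j : Hb n) : ∃ m : Hb n, Apart m i ∧ Apart m j := by
  have hc : ({Sum.elim id id i, Sum.elim id id j} : Finset (Fin n)).card <
      (Finset.univ : Finset (Fin n)).card :=
    lt_of_le_of_lt Finset.card_le_two (by simpa using by omega)
  obtain ⟨k, -, hk⟩ := Finset.exists_mem_notMem_of_card_lt_card hc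
  simp only [Finset.mem_insert, Finset.mem_singleton, not_or] at hk
  exact ⟨Sum.inl k, apart_iff.2 hk.1, apart_iff.2 hk.2⟩

/-! ### The quadratic space -/

/-- The basis vector `e_i` for `i ∈ Θ_hb`. -/
def e (i : Hb n) : Theta n → R := Pi.single (hb i) 1

/-- The basis vector `e_0`. -/
def eZero : Theta n → R := Pi.single zero 1

theorem polarForm_comm (u v : Theta n → R) : polarForm u v = polarForm v u := by
  unfold polarForm
  congr 1
  · refine Fintype.sum_equiv (Equiv.sumComm _ _) _ _ fun i => ?_
    simp [Equiv.sumComm_apply, mul_comm]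
  · ring

@[simp] theorem polarForm_add_left (u u' v : Theta n → R) :
    polarForm (u + u') v = polarForm u v + polarForm u' v := by
  simp only [polarForm, Pi.add_apply, add_mul, Finset.sum_add_distrib]
  ring

@[simp] theorem polarForm_smul_left (c : R) (u v : Theta n → R) :
    polarForm (c • u) v = c * polarForm u v := by
  simp only [polarForm, Pi.smul_apply, smul_eq_mul, mul_add, Finset.mul_sum]
  congr 1
  · exact Finset.sum_congr rfl fun _ _ => by ring
  · ring

@[simp] theorem polarForm_add_right (u v v' : Theta n → R) :
    polarForm u (v + v') = polarForm u v + polarForm u v' := by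
  rw [polarForm_comm, polarForm_add_left, polarForm_comm v, polarForm_comm v']

@[simp] theorem polarForm_smul_right (c : R) (u v : Theta n → R) :
    polarForm u (c • v) = c * polarForm u v := by
  rw [polarForm_comm, polarForm_smul_left, polarForm_comm v]

@[simp] theorem polarForm_neg_left (u v : Theta n → R) : polarForm (-u) v = -polarForm u v := by
  rw [← neg_one_smul R u, polarForm_smul_left, neg_one_mul]

@[simp] theorem polarForm_neg_right (u v : Theta n → R) : polarForm u (-v) = -polarForm u v := by
  rw [polarForm_comm, polarForm_neg_left, polarForm_comm v]

@[simp] theorem polarForm_sub_left (u u' v : Theta n → R) :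
    polarForm (u - u') v = polarForm u v - polarForm u' v := by
  rw [sub_eq_add_neg, polarForm_add_left, polarForm_neg_left, sub_eq_add_neg]

@[simp] theorem polarForm_sub_right (u v v' : Theta n → R) :
    polarForm u (v - v') = polarForm u v - polarForm u v' := by
  rw [sub_eq_add_neg, polarForm_add_right, polarForm_neg_right, sub_eq_add_neg]

@[simp] theorem polarForm_zero_left (v : Theta n → R) : polarForm 0 v = 0 := by
  simp [polarForm]

@[simp] theorem polarForm_zero_right (v : Theta n → R) : polarForm v 0 = 0 := by
  simp [polarForm]

@[simp] theorem polarForm_e_right (u : Theta n → R) (i : Hb n) :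
    polarForm u (e i) = u (hb i.swap) := by
  rw [e, polarForm_single_hb, mul_one]

@[simp] theorem polarForm_e_left (u : Theta n → R) (i : Hb n) :
    polarForm (e i) u = u (hb i.swap) := by
  rw [polarForm_comm, polarForm_e_right]

@[simp] theorem polarForm_eZero_right (u : Theta n → R) :
    polarForm u eZero = 2 * u zero := by
  rw [eZero, polarForm_single_zero, mul_one]

@[simp] theorem polarForm_eZero_left (u : Theta n → R) :
    polarForm eZero u = 2 * u zero := by
  rw [polarForm_comm, polarForm_eZero_right]

@[simp] theorem Q_smul (c : R) (u : Theta n → R) : Q (c • u) = c ^ 2 * Q u := by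
  simp only [Q, Pi.smul_apply, smul_eq_mul, mul_add, Finset.mul_sum]
  congr 1
  · exact Finset.sum_congr rfl fun _ _ => by ring
  · ring

@[simp] theorem Q_neg (u : Theta n → R) : Q (-u) = Q u := by
  rw [← neg_one_smul R u, Q_smul]
  ring

theorem Q_sub (u v : Theta n → R) : Q (u - v) = Q u + Q v - polarForm u v := by
  rw [sub_eq_add_neg, Q_add, Q_neg, polarForm_neg_right, sub_eq_add_neg]

theorem polarForm_self (u : Theta n → R) : polarForm u u = 2 * Q u := by
  have h := Q_add u u
  rw [← two_smul R u, Q_smul] at h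
  linear_combination -h

@[simp] theorem Q_e (i : Hb n) : Q (e i : Theta n → R) = 0 := Q_single_hb i 1

@[simp] theorem Q_eZero : Q (eZero : Theta n → R) = 1 := by
  rw [eZero, Q_single_zero, one_pow]

@[simp] theorem e_apply_self (i : Hb n) : (e i : Theta n → R) (hb i) = 1 := by simp [e]

@[simp] theorem e_apply_zero (i : Hb n) : (e i : Theta n → R) zero = 0 := by simp [e]

@[simp] theorem eZero_apply_zero : (eZero : Theta n → R) zero = 1 := by simp [eZero]

@[simp] theorem eZero_apply_hb (i : Hb n) : (eZero : Theta n → R) (hb i) = 0 := by simp [eZero]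

theorem e_apply_of_ne {i j : Hb n} (h : i ≠ j) : (e i : Theta n → R) (hb j) = 0 := by
  simp [e, h.symm]

@[simp] theorem e_apply_swap (i : Hb n) : (e i : Theta n → R) (hb i.swap) = 0 :=
  e_apply_of_ne (ne_swap i)

@[simp] theorem e_swap_apply (i : Hb n) : (e i.swap : Theta n → R) (hb i) = 0 :=
  e_apply_of_ne (swap_ne i)

@[simp] theorem Apart.e_apply {i j : Hb n} (h : Apart i j) : (e i : Theta n → R) (hb j) = 0 :=
  e_apply_of_ne h.1

@[simp] theorem Apart.e_apply_swap {i j : Hb n} (h : Apart i j) :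
    (e i : Theta n → R) (hb j.swap) = 0 :=
  e_apply_of_ne h.2

@[simp] theorem Apart.e_swap_apply {i j : Hb n} (h : Apart i j) :
    (e i.swap : Theta n → R) (hb j) = 0 :=
  h.swap_left.e_apply

@[simp] theorem Apart.e_swap_apply_swap {i j : Hb n} (h : Apart i j) :
    (e i.swap : Theta n → R) (hb j.swap) = 0 :=
  h.swap_left.e_apply_swap

theorem eq_sum_e (w : Theta n → R) :
    w = w zero • eZero + ∑ i : Hb n, w (hb i) • e i := by
  funext j
  rcases j with ⟨⟩ | j
  · rw [Pi.add_apply, Finset.sum_apply, Finset.sum_eq_zero fun i _ => ?_]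
    · exact (by simp : w zero = (w zero • (eZero : Theta n → R)) zero + 0)
    · exact (by simp : (w (hb i) • (e i : Theta n → R)) zero = 0)
  · rw [Pi.add_apply, Finset.sum_apply, Finset.sum_eq_single j]
    · simp
    · intro i _ hi
      simp [e_apply_of_ne hi]
    · simp

/-! ### The action of the orthogonal group -/

/-- The action of `O_{2n+1}(R)` on `R^{2n+1}`. -/
def act : orthogonal n R →* Module.End R (Theta n → R) where
  toFun σ := Matrix.mulVecLin σ.1.1
  map_one' := by simp; rfl
  map_mul' σ τ := by simp [Matrix.mulVecLin_mul]; rfl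

theorem act_apply (σ : orthogonal n R) (w : Theta n → R) : act σ w = σ.1.1 *ᵥ w := rfl

theorem act_mul (σ τ : orthogonal n R) (w : Theta n → R) : act (σ * τ) w = act σ (act τ w) := by
  rw [map_mul, Module.End.mul_apply]

@[simp] theorem act_one (w : Theta n → R) : act (1 : orthogonal n R) w = w := by
  rw [map_one, Module.End.one_apply]

@[simp] theorem act_inv_act (σ : orthogonal n R) (w : Theta n → R) : act σ⁻¹ (act σ w) = w := by
  rw [← act_mul, inv_mul_cancel, act_one]

theorem ext_act {σ τ : orthogonal n R} (h : ∀ w, act σ w = act τ w) : σ = τ := by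
  apply Subtype.ext
  apply Units.ext
  exact Matrix.mulVec_injective (funext h)

@[simp] theorem Q_act (σ : orthogonal n R) (w : Theta n → R) : Q (act σ w) = Q w := σ.2 w

@[simp] theorem polarForm_act (σ : orthogonal n R) (u v : Theta n → R) :
    polarForm (act σ u) (act σ v) = polarForm u v := by
  have h := Q_act σ (u + v)
  rw [map_add, Q_add, Q_add, Q_act, Q_act] at h
  linear_combination h

theorem act_e_apply (σ : orthogonal n R) (i : Hb n) (k : Theta n) :
    act σ (e i) k = σ.1.1 k (hb i) := by
  simp [act_apply, e]

theorem act_eZero_apply (σ : orthogonal n R) (k : Theta n) :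
    act σ eZero k = σ.1.1 k zero := by
  simp [act_apply, eZero]

/-! ### Siegel transformations -/

/-- The linear map `w ↦ w + B(v,w) u - B(u,w) v - Q(v) B(u,w) u`. -/
def siegelMap (u v : Theta n → R) : Module.End R (Theta n → R) where
  toFun w := w + polarForm v w • u - polarForm u w • v - (Q v * polarForm u w) • u
  map_add' w w' := by
    simp only [polarForm_add_right]
    module
  map_smul' c w := by
    simp only [polarForm_smul_right, RingHom.id_apply]
    module

theorem siegelMap_apply (u v w : Theta n → R) : siegelMap u v w =
    w + polarForm v w • u - polarForm u w • v - (Q v * polarForm u w) • u := rfl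

theorem siegelMap_siegelMap {u v v' : Theta n → R} (hu : Q u = 0) (hv : polarForm u v = 0)
    (hv' : polarForm u v' = 0) (w : Theta n → R) :
    siegelMap u v (siegelMap u v' w) = siegelMap u (v + v') w := by
  have h1 : polarForm u u = 0 := by rw [polarForm_self, hu, mul_zero]
  have h2 : polarForm v u = 0 := by rw [polarForm_comm, hv]
  simp only [siegelMap_apply, polarForm_add_right, polarForm_sub_right, polarForm_smul_right,
    polarForm_add_left, h1, h2, hv', Q_add]
  module

theorem siegelMap_zero (u w : Theta n → R) : siegelMap u 0 w = w := by
  have : Q (0 : Theta n → R) = 0 := by simp [Q]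
  simp [siegelMap_apply, this]

theorem Q_siegelMap {u v : Theta n → R} (hu : Q u = 0) (hv : polarForm u v = 0)
    (w : Theta n → R) : Q (siegelMap u v w) = Q w := by
  have h1 : polarForm u u = 0 := by rw [polarForm_self, hu, mul_zero]
  have h2 : polarForm v u = 0 := by rw [polarForm_comm, hv]
  simp only [siegelMap_apply, Q_sub, Q_add, Q_smul, polarForm_add_left, polarForm_sub_left,
    polarForm_smul_left, polarForm_smul_right, hu, h1, h2, hv, polarForm_comm w]
  ring

theorem toMatrix'_siegelMap_mul_neg {u v : Theta n → R} (hu : Q u = 0) (hv : polarForm u v = 0) :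
    LinearMap.toMatrix' (siegelMap u v) * LinearMap.toMatrix' (siegelMap u (-v)) = 1 := by
  rw [← LinearMap.toMatrix'_mul, ← LinearMap.toMatrix'_one (R := R)]
  congr 1
  refine LinearMap.ext fun w => ?_
  rw [Module.End.mul_apply, siegelMap_siegelMap hu hv (by simp [hv]), add_neg_cancel,
    siegelMap_zero, Module.End.one_apply]

open Classical in
/-- The Siegel (or Eichler) transformation
`w ↦ w + B(v,w) u - B(u,w) v - Q(v) B(u,w) u` attached to an isotropic vector `u` and a vector `v`
orthogonal to it. By convention it is the identity if these conditions fail. -/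
noncomputable def siegel (u v : Theta n → R) : orthogonal n R :=
  if h : Q u = 0 ∧ polarForm u v = 0 then
    ⟨⟨LinearMap.toMatrix' (siegelMap u v), LinearMap.toMatrix' (siegelMap u (-v)),
      toMatrix'_siegelMap_mul_neg h.1 h.2,
      by simpa using toMatrix'_siegelMap_mul_neg (v := -v) h.1 (by simp [h.2])⟩,
      fun w => by
        rw [LinearMap.toMatrix'_mulVec]
        exact Q_siegelMap h.1 h.2 w⟩
  else 1

theorem act_siegel {u v : Theta n → R} (hu : Q u = 0) (hv : polarForm u v = 0)
    (w : Theta n → R) : act (siegel u v) w =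
      w + polarForm v w • u - polarForm u w • v - (Q v * polarForm u w) • u := by
  rw [siegel, dif_pos ⟨hu, hv⟩]
  exact LinearMap.toMatrix'_mulVec (siegelMap u v) w

theorem siegel_conj (g : orthogonal n R) (u v : Theta n → R) :
    g * siegel u v * g⁻¹ = siegel (act g u) (act g v) := by
  by_cases h : Q u = 0 ∧ polarForm u v = 0
  · refine ext_act fun w => ?_
    obtain ⟨w, rfl⟩ : ∃ w', w = act g w' := ⟨act g⁻¹ w, by simp⟩
    rw [act_mul, act_mul, act_inv_act, act_siegel h.1 h.2, act_siegel (by simpa using h.1)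
      (by simpa using h.2)]
    simp
  · rw [siegel, dif_neg h, siegel, dif_neg (by simpa using h)]
    simp

theorem siegel_add (u : Theta n → R) {v v' : Theta n → R} (hv : polarForm u v = 0)
    (hv' : polarForm u v' = 0) : siegel u (v + v') = siegel u v * siegel u v' := by
  by_cases hu : Q u = 0
  · refine ext_act fun w => ?_
    rw [act_mul, act_siegel hu hv', act_siegel hu hv, act_siegel hu (by simp [hv, hv'])]
    exact (siegelMap_siegelMap hu hv hv' w).symm
  · simp [siegel, hu]

@[simp] theorem siegel_zero (u : Theta n → R) : siegel u 0 = 1 := by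
  have h := siegel_add u (polarForm_zero_right u) (polarForm_zero_right u)
  rw [add_zero] at h
  exact left_eq_mul.1 h

theorem siegel_neg (u : Theta n → R) {v : Theta n → R} (hv : polarForm u v = 0) :
    siegel u (-v) = (siegel u v)⁻¹ := by
  rw [eq_inv_iff_mul_eq_one, ← siegel_add u (by simp [hv]) hv, neg_add_cancel, siegel_zero]

theorem siegel_self (u : Theta n → R) (c : R) : siegel u (c • u) = 1 := by
  by_cases hu : Q u = 0
  · have h1 : polarForm u u = 0 := by rw [polarForm_self, hu, mul_zero]
    refine ext_act fun w => ?_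
    rw [act_siegel hu (by simp [h1]), Q_smul, hu, polarForm_smul_left, act_one]
    module
  · simp [siegel, hu]

theorem siegel_swap {u v : Theta n → R} (hu : Q u = 0) (hv : Q v = 0) (huv : polarForm u v = 0) :
    siegel u v = siegel v (-u) := by
  refine ext_act fun w => ?_
  rw [act_siegel hu huv, act_siegel hv (by rw [polarForm_comm]; simp [huv]), Q_neg, hu, hv,
    polarForm_neg_left]
  module

theorem siegel_smul {u v : Theta n → R} (c : R) (hu : Q u = 0) (hv : polarForm u v = 0) :
    siegel (c • u) v = siegel u (c • v) := by
  refine ext_act fun w => ?_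
  rw [act_siegel (by simp [hu]) (by simp [hv]), act_siegel hu (by simp [hv])]
  simp only [polarForm_smul_left, Q_smul]
  module

/-- Additivity in the isotropic argument holds up to a correction by `Q v`. -/
theorem siegel_add_left {u u' v : Theta n → R} (hu : Q u = 0) (hu' : Q u' = 0)
    (huu' : polarForm u u' = 0) (hv : polarForm u v = 0) (hv' : polarForm u' v = 0) :
    siegel (u + u') v = siegel u v * siegel u' v * siegel u (Q v • u') := by
  have h1 : polarForm u u = 0 := by rw [polarForm_self, hu, mul_zero]
  have h2 : polarForm u' u' = 0 := by rw [polarForm_self, hu', mul_zero]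
  have h3 : polarForm v u = 0 := by rw [polarForm_comm, hv]
  have h4 : polarForm u' u = 0 := by rw [polarForm_comm, huu']
  have h5 : polarForm v u' = 0 := by rw [polarForm_comm, hv']
  refine ext_act fun w => ?_
  rw [act_mul, act_mul, act_siegel (v := Q v • u') hu (by simp [huu']),
    act_siegel (v := v) (u := u') hu' hv', act_siegel (v := v) (u := u) hu hv,
    act_siegel (by rw [Q_add, hu, hu', huu']; ring) (by simp [hv, hv'])]
  simp only [polarForm_add_left, polarForm_add_right, polarForm_sub_right, polarForm_smul_left,
    polarForm_smul_right, Q_smul, hu', h1, h2, h3, h4, h5, huu', hv, polarForm_self v]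
  module

theorem shortRoot_eq_siegel (i j : Hb n) (hij : i ≠ j ∧ i ≠ j.swap) (x : R) :
    shortRoot i j hij x = siegel (e i) (x • e j.swap) := by
  refine ext_act fun w => ?_
  rw [act_siegel (Q_e i) (by
    rw [polarForm_smul_right, polarForm_e_right, Sum.swap_swap,
      Apart.e_apply (show Apart i j from hij), mul_zero]), act_apply]
  change shortRootMatrix i j x *ᵥ w = _
  simp only [shortRootMatrix, Matrix.add_mulVec, Matrix.sub_mulVec, Matrix.one_mulVec,
    Matrix.single_mulVec, polarForm_smul_left, polarForm_e_left, Q_smul, Q_e, Sum.swap_swap]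
  funext k
  simp [e, Function.update_apply, Pi.single_apply, mul_comm x]

theorem extraShortRoot_eq_siegel (i : Hb n) (x : R) :
    extraShortRoot i x = siegel (e i) (-x • eZero) := by
  refine ext_act fun w => ?_
  rw [act_siegel (Q_e i) (by simp), act_apply]
  change extraShortRootMatrix i x *ᵥ w = _
  simp only [extraShortRootMatrix, Matrix.add_mulVec, Matrix.sub_mulVec, Matrix.one_mulVec,
    Matrix.single_mulVec, polarForm_smul_left, polarForm_e_left, polarForm_eZero_left, Q_smul,
    Q_eZero]
  funext k
  simp [e, eZero, Function.update_apply, Pi.single_apply]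
  split_ifs <;> ring

/-! ### Subgroups normalized by the elementary group -/

/-- `N` is normalized by `EO_{2n+1}(R)` and contains `EO_{2n+1}(I,J)`. -/
structure IsAbove (P : AdmissiblePair R) (N : Subgroup (orthogonal n R)) : Prop where
  conj_mem : ∀ ε ∈ elementary n R, ∀ σ ∈ N, ε * σ * ε⁻¹ ∈ N
  le : preElementary n P ≤ N

/-- The admissible pair `(R, R)`. -/
def topPair (R : Type*) [CommRing R] : AdmissiblePair R := ⟨⊤, ⊤, by simp, by simp, le_rfl⟩

theorem isAbove_elementary : IsAbove (topPair R) (elementary n R) :=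
  ⟨fun _ hε _ hσ => mul_mem (mul_mem hε hσ) (inv_mem hε), preElementary_le_elementary n _⟩

namespace IsAbove

variable {P : AdmissiblePair R} {N : Subgroup (orthogonal n R)}

theorem siegel_e_e_mem (hN : IsAbove P N) {i k : Hb n} (h : Apart i k) {x : R} (hx : x ∈ P.I) :
    siegel (e i) (x • e k) ∈ N := by
  have h' : shortRoot i k.swap h.swap_right x = siegel (e i) (x • e k) := by
    rw [shortRoot_eq_siegel i k.swap h.swap_right, Sum.swap_swap]
  rw [← h']
  exact hN.le (Subgroup.subset_closure (Or.inl ⟨i, k.swap, h.swap_right, x, hx, rfl⟩))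

theorem siegel_e_eZero_mem (hN : IsAbove P N) (i : Hb n) {x : R} (hx : x ∈ P.J) :
    siegel (e i) (x • eZero) ∈ N := by
  refine hN.le (Subgroup.subset_closure (Or.inr ⟨i, -x, P.J.neg_mem hx, ?_⟩))
  rw [extraShortRoot_eq_siegel, neg_neg]

theorem commutator_mem (hN : IsAbove P N) {g s : orthogonal n R} (hg : g ∈ N)
    (hs : s ∈ elementary n R) : g * s * g⁻¹ * s⁻¹ ∈ N := by
  have h := mul_mem hg (inv_mem (hN.conj_mem s hs g hg))
  rwa [mul_inv_rev, mul_inv_rev, inv_inv, ← mul_assoc, ← mul_assoc] at h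

end IsAbove

/-! ### Small vectors -/

/-- The vectors whose coordinates with index in `Θ_hb` lie in `I` and whose coordinate with index
`0` lies in `J`. -/
def smallVectors (n : ℕ) (P : AdmissiblePair R) : Submodule R (Theta n → R) where
  carrier := {v | (∀ i : Hb n, v (hb i) ∈ P.I) ∧ v zero ∈ P.J}
  zero_mem' := ⟨fun _ => P.I.zero_mem, P.J.zero_mem⟩
  add_mem' hv hw := ⟨fun i => P.I.add_mem (hv.1 i) (hw.1 i), P.J.add_mem hv.2 hw.2⟩
  smul_mem' c _ hv := ⟨fun i => P.I.mul_mem_left c (hv.1 i), P.J.mul_mem_left c hv.2⟩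

theorem mem_smallVectors {P : AdmissiblePair R} {v : Theta n → R} :
    v ∈ smallVectors n P ↔ (∀ i : Hb n, v (hb i) ∈ P.I) ∧ v zero ∈ P.J := Iff.rfl

theorem smul_mem_smallVectors {P : AdmissiblePair R} {c : R} (hc : c ∈ P.I) (v : Theta n → R) :
    c • v ∈ smallVectors n P :=
  ⟨fun _ => P.I.mul_mem_right _ hc, P.J.mul_mem_right _ (P.le hc)⟩

theorem smul_eZero_mem_smallVectors {P : AdmissiblePair R} {c : R} (hc : c ∈ P.J) :
    (c • eZero : Theta n → R) ∈ smallVectors n P := by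
  simp [mem_smallVectors, hc]

/-- The vectors `v` orthogonal to `u` whose Siegel transformation with respect to `u` lies
in `N`. -/
def siegelSub (u : Theta n → R) (N : Subgroup (orthogonal n R)) : AddSubgroup (Theta n → R) where
  carrier := {v | polarForm u v = 0 ∧ siegel u v ∈ N}
  zero_mem' := by simp
  add_mem' := by
    rintro v w ⟨hv, hv'⟩ ⟨hw, hw'⟩
    exact ⟨by simp [hv, hw], by rw [siegel_add u hv hw]; exact mul_mem hv' hw'⟩
  neg_mem' := by
    rintro v ⟨hv, hv'⟩
    exact ⟨by simp [hv], by rw [siegel_neg u hv]; exact inv_mem hv'⟩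

theorem smul_self_mem_siegelSub {u : Theta n → R} (hu : Q u = 0) (N : Subgroup (orthogonal n R))
    (c : R) : c • u ∈ siegelSub u N :=
  ⟨by rw [polarForm_smul_right, polarForm_self, hu, mul_zero, mul_zero],
    by rw [siegel_self]; exact one_mem N⟩

/-- A commutator with an isometry fixing `u` is again a Siegel transformation along `u`. -/
theorem siegel_act_sub {g : orthogonal n R} {u v : Theta n → R} (hg : act g u = u)
    (hv : polarForm u v = 0) :
    siegel u (act g v - v) = g * siegel u v * g⁻¹ * (siegel u v)⁻¹ := by
  rw [siegel_conj, hg, ← siegel_neg u hv, ← siegel_add u _ (by simp [hv]), sub_eq_add_neg]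
  rw [← hg, polarForm_act, hv]

theorem act_siegel_of_orthogonal {a b w : Theta n → R} (h : polarForm a w = 0)
    (h' : polarForm b w = 0) : act (siegel a b) w = w := by
  by_cases hab : Q a = 0 ∧ polarForm a b = 0
  · rw [act_siegel hab.1 hab.2, h, h']
    simp
  · rw [siegel, dif_neg hab, act_one]

namespace IsAbove

variable {P : AdmissiblePair R} {N : Subgroup (orthogonal n R)}

theorem act_sub_mem_siegelSub (hN : IsAbove P N) {g : orthogonal n R} {u v : Theta n → R}
    (hg : g ∈ N) (hgu : act g u = u) (hv : v ∈ siegelSub u (elementary n R)) :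
    act g v - v ∈ siegelSub u N := by
  refine ⟨?_, by rw [siegel_act_sub hgu hv.1]; exact hN.commutator_mem hg hv.2⟩
  have h : polarForm u (act g v) = 0 := by rw [← hgu, polarForm_act, hv.1]
  rw [polarForm_sub_right, h, hv.1, sub_zero]

/-- Small vectors orthogonal to `e_i` give products of generators; the coordinate with index `i`
plays no role. -/
theorem mem_siegelSub_e (hN : IsAbove P N) {i : Hb n} {y : Theta n → R}
    (hi : y (hb i.swap) = 0) (hI : ∀ k, Apart i k → y (hb k) ∈ P.I) (hJ : y zero ∈ P.J) :
    y ∈ siegelSub (e i) N := by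
  rw [eq_sum_e y]
  refine add_mem ⟨by simp, hN.siegel_e_eZero_mem i hJ⟩ (sum_mem fun k _ => ?_)
  by_cases h1 : i = k
  · rw [h1]
    exact smul_self_mem_siegelSub (Q_e k) N _
  · by_cases h2 : i = k.swap
    · rw [h2, Sum.swap_swap] at hi
      rw [hi, zero_smul]
      exact zero_mem _
    · have h : Apart i k := ⟨h1, h2⟩
      exact ⟨by simp [h], hN.siegel_e_e_mem h (hI k h)⟩

theorem mem_siegelSub_e_of_small (hN : IsAbove P N) {i : Hb n} {y : Theta n → R}
    (hi : y (hb i.swap) = 0) (hy : y ∈ smallVectors n P) : y ∈ siegelSub (e i) N :=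
  hN.mem_siegelSub_e hi (fun k _ => hy.1 k) hy.2

end IsAbove

/-! ### Siegel transformations along vectors supported on two indices -/

theorem Q_pair {k l : Hb n} (h : Apart k l) (a b : R) :
    Q (a • e k + b • e l : Theta n → R) = 0 := by
  rw [Q_add]
  simp [h]

namespace IsAbove

variable {P : AdmissiblePair R} {N : Subgroup (orthogonal n R)}

theorem smul_e_mem_siegelSub_pair (hN : IsAbove P N) {k l m : Hb n} (h : Apart k l)
    (hk : k ≠ m.swap) (hl : l ≠ m.swap) (a b : R) {c : R} (hc : c ∈ P.I) :
    c • e m ∈ siegelSub (a • e k + b • e l) N := by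
  have h0 : polarForm (a • e k + b • e l) (e m : Theta n → R) = 0 := by
    simp [e_apply_of_ne hk, e_apply_of_ne hl]
  refine ⟨by rw [polarForm_smul_right, h0, mul_zero], ?_⟩
  have h1 : polarForm (e m : Theta n → R) (a • e k + b • e l) = 0 := by rw [polarForm_comm, h0]
  rw [siegel_swap (Q_pair h a b) (by simp) (by rw [polarForm_smul_right, h0, mul_zero]),
    siegel_smul c (Q_e m) (by rw [polarForm_neg_right, h1, neg_zero])]
  exact (hN.mem_siegelSub_e_of_small
    (by rw [← polarForm_e_left (c • -_), polarForm_smul_right, polarForm_neg_right, h1]; simp)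
    (smul_mem_smallVectors hc _)).2

theorem smul_eZero_mem_siegelSub_pair (hN : IsAbove P N) {k l : Hb n} (h : Apart k l)
    (a b : R) {c : R} (hc : c ∈ P.J) :
    c • eZero ∈ siegelSub (a • e k + b • e l) N := by
  refine ⟨by simp, ?_⟩
  rw [siegel_add_left (by simp) (by simp) (by simp [h]) (by simp) (by simp),
    siegel_smul a (Q_e k) (by simp), siegel_smul b (Q_e l) (by simp),
    siegel_smul a (Q_e k) (by simp [h]), smul_smul, smul_smul, smul_smul, smul_smul]
  refine mul_mem (mul_mem ?_ ?_) ?_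
  · exact hN.siegel_e_eZero_mem k (P.J.mul_mem_left a hc)
  · exact hN.siegel_e_eZero_mem l (P.J.mul_mem_left b hc)
  · refine hN.siegel_e_e_mem h (P.I.mul_mem_right b (P.I.mul_mem_left a ?_))
    rw [Q_smul, Q_eZero, mul_one]
    exact P.sq_mem c hc

/-- A vector in the span of `e_{-k}` and `e_{-l}` is reached through a commutator involving a third
index; this is where `n ≥ 3` is needed. -/
theorem pair_mem_siegelSub_pair (hN : IsAbove P N) (hn : 3 ≤ n) {k l : Hb n} (h : Apart k l)
    {a b α β : R} (hab : a * α + b * β = 0) (hα : α ∈ P.I) (hβ : β ∈ P.I) :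
    α • e k.swap + β • e l.swap ∈ siegelSub (a • e k + b • e l) N := by
  obtain ⟨m, hk, hl⟩ := exists_apart hn k l
  set z : Theta n → R := α • e k.swap + β • e l.swap with hz
  have hz0 : Q z = 0 := Q_pair h.swap_left.swap_right α β
  have hg : siegel (e m.swap) z ∈ N := by
    refine (hN.mem_siegelSub_e_of_small ?_ (add_mem (smul_mem_smallVectors hα _)
      (smul_mem_smallVectors hβ _))).2
    simp [hk.symm, hl.symm]
  have hmz : polarForm (e m.swap) z = 0 := by simp [hz, hk, hl]
  -- The transformation `siegel (e m.swap) z` fixes the plane vector and maps `e m` to `e m - z`.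
  have hw : act (siegel (e m.swap) z) (a • e k + b • e l) = a • e k + b • e l := by
    refine act_siegel_of_orthogonal (by simp [hk, hl]) ?_
    simp only [hz, polarForm_add_left, polarForm_add_right, polarForm_smul_left,
      polarForm_smul_right, polarForm_e_left, Sum.swap_swap, e_apply_self, h.e_apply,
      h.symm.e_apply]
    linear_combination hab
  have he : e m ∈ siegelSub (a • e k + b • e l) (elementary n R) := by
    rw [← one_smul R (e m)]
    exact isAbove_elementary.smul_e_mem_siegelSub_pair h hk.symm.2 hl.symm.2 a b Submodule.mem_top
  have hmem := hN.act_sub_mem_siegelSub hg hw he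
  have hm : act (siegel (e m.swap) z) (e m) - e m = -z := by
    rw [act_siegel (Q_e _) hmz, hz0]
    simp [hz, hk.symm, hl.symm]
  rw [hm] at hmem
  simpa using neg_mem hmem

/-- For an isotropic vector `w` supported on two indices, the Siegel transformation of every small
vector orthogonal to `w` lies in `N`. -/
theorem mem_siegelSub_pair (hN : IsAbove P N) (hn : 3 ≤ n) {k l : Hb n} (h : Apart k l)
    {a b : R} {z : Theta n → R} (hz : z ∈ smallVectors n P)
    (hwz : polarForm (a • e k + b • e l) z = 0) :
    z ∈ siegelSub (a • e k + b • e l) N := by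
  set z' : Theta n → R := z (hb k.swap) • e k.swap + z (hb l.swap) • e l.swap with hz'
  have h1 : z' ∈ siegelSub (a • e k + b • e l) N :=
    hN.pair_mem_siegelSub_pair hn h (by simpa using hwz) (hz.1 _) (hz.1 _)
  have h2 : z - z' ∈ smallVectors n P :=
    sub_mem hz (add_mem (smul_mem_smallVectors (hz.1 _) _) (smul_mem_smallVectors (hz.1 _) _))
  rw [← sub_add_cancel z z', eq_sum_e (z - z')]
  refine add_mem (add_mem (hN.smul_eZero_mem_siegelSub_pair h a b h2.2)
    (sum_mem fun m _ => ?_)) h1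
  by_cases hk : k = m.swap
  · obtain rfl : m = k.swap := by rw [hk, Sum.swap_swap]
    have : (z - z') (hb k.swap) = 0 := by simp [hz', h.symm]
    rw [this, zero_smul]
    exact zero_mem _
  · by_cases hl : l = m.swap
    · obtain rfl : m = l.swap := by rw [hl, Sum.swap_swap]
      have : (z - z') (hb l.swap) = 0 := by simp [hz', h]
      rw [this, zero_smul]
      exact zero_mem _
    · exact hN.smul_e_mem_siegelSub_pair h hk hl a b (h2.1 m)

end IsAbove

/-! ### Siegel transformations along a unimodular isotropic vector -/

/-- The vector `u_{-l} e_k - u_{-k} e_l`. It is orthogonal to `u`, and isotropic if `k ≠ ±l`. -/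
def tangent (u : Theta n → R) (k l : Hb n) : Theta n → R :=
  u (hb l.swap) • e k + (-u (hb k.swap)) • e l

theorem polarForm_tangent (u : Theta n → R) (k l : Hb n) : polarForm (tangent u k l) u = 0 := by
  simp only [tangent, polarForm_add_left, polarForm_smul_left, polarForm_e_left]
  ring

theorem Q_tangent (u : Theta n → R) {k l : Hb n} (h : Apart k l) : Q (tangent u k l) = 0 :=
  Q_pair h _ _

theorem siegel_smul_tangent {u : Theta n → R} (hu : Q u = 0) {k l : Hb n} (h : Apart k l) (c : R) :
    siegel u (c • tangent u k l) = siegel (tangent u k l) (c • -u) := by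
  have h0 := polarForm_tangent u k l
  rw [siegel_swap hu (by rw [Q_smul, Q_tangent u h, mul_zero])
    (by rw [polarForm_comm, polarForm_smul_left, h0, mul_zero]),
    siegel_smul c (Q_tangent u h) (by rw [polarForm_neg_right, h0, neg_zero])]

namespace IsAbove

variable {P : AdmissiblePair R} {N : Subgroup (orthogonal n R)}

theorem smul_tangent_mem (hN : IsAbove P N) (hn : 3 ≤ n) {u : Theta n → R} (hu : Q u = 0)
    {k l : Hb n} (h : Apart k l) {c : R} (hc : c ∈ P.I) :
    c • tangent u k l ∈ siegelSub u N := by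
  have h0 := polarForm_tangent u k l
  refine ⟨by rw [polarForm_comm, polarForm_smul_left, h0, mul_zero], ?_⟩
  rw [siegel_smul_tangent hu h]
  refine (hN.mem_siegelSub_pair hn h (smul_mem_smallVectors hc _) ?_).2
  change polarForm (tangent u k l) (c • -u) = 0
  rw [polarForm_smul_right, polarForm_neg_right, h0, neg_zero, mul_zero]

/-- The vector `u_l e_0 - 2 u_0 e_{-l}` is orthogonal to `u` but not isotropic; its Siegel
transformation is reached, after multiplication by `u_l²`, through a commutator with a
transformation fixing `u`. -/
theorem smul_tangent_zero_mem (hN : IsAbove P N) (hn : 3 ≤ n) {u : Theta n → R} (hu : Q u = 0)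
    (l : Hb n) {c : R} (hc : c ∈ P.J) :
    (c * u (hb l) ^ 2) • (u (hb l) • eZero - (2 * u zero) • e l.swap) ∈ siegelSub u N := by
  obtain ⟨m, hm, -⟩ := exists_apart hn l l
  set w : Theta n → R := u (hb l) • eZero - (2 * u zero) • e l.swap with hw
  have hcw : c • w ∈ smallVectors n P := by
    rw [hw, smul_sub, smul_smul, smul_smul]
    refine sub_mem (smul_eZero_mem_smallVectors (P.J.mul_mem_right _ hc))
      (smul_mem_smallVectors ?_ _)
    rw [mul_left_comm, ← mul_assoc]
    exact P.I.mul_mem_right _ (P.two_mul_mem c hc)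
  have hml := hm.swap_right
  have hml' := hm.swap_left.swap_right
  have hfw : polarForm (tangent u m l.swap) w = 0 := by
    simp [tangent, hw, hm]
  have hg : siegel (tangent u m l.swap) (c • w) ∈ N :=
    (hN.mem_siegelSub_pair hn hml hcw (by
      change polarForm (tangent u m l.swap) (c • w) = 0
      rw [polarForm_smul_right, hfw, mul_zero])).2
  have hwu : polarForm w u = 0 := by
    simp only [hw, polarForm_sub_left, polarForm_smul_left, polarForm_eZero_left, polarForm_e_left,
      Sum.swap_swap]
    ring
  have hgu : act (siegel (tangent u m l.swap) (c • w)) u = u :=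
    act_siegel_of_orthogonal (polarForm_tangent u _ _) (by
      rw [polarForm_smul_left, hwu, mul_zero])
  have hv : tangent u m.swap l.swap ∈ siegelSub u (elementary n R) := by
    rw [← one_smul R (tangent u m.swap l.swap)]
    exact isAbove_elementary.smul_tangent_mem hn hu hml' Submodule.mem_top
  have hmem := hN.act_sub_mem_siegelSub hg hgu hv
  have h1 : polarForm (tangent u m l.swap) (tangent u m.swap l.swap) = u (hb l) ^ 2 := by
    simp [tangent, hm, hm.symm, pow_two]
  have h2 : polarForm w (tangent u m.swap l.swap) = 0 := by
    simp [tangent, hw, hm.symm]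
  have h3 : Q w = u (hb l) ^ 2 := by
    simp [hw, Q_sub]
  have h4 : act (siegel (tangent u m l.swap) (c • w)) (tangent u m.swap l.swap) -
      tangent u m.swap l.swap =
      -((c * u (hb l) ^ 2) • w) - (c ^ 2 * u (hb l) ^ 4) • tangent u m l.swap := by
    rw [act_siegel (Q_tangent u hml) (by rw [polarForm_smul_right, hfw, mul_zero]), h1,
      polarForm_smul_left, h2, Q_smul, h3]
    module
  rw [h4] at hmem
  have h5 := add_mem hmem (hN.smul_tangent_mem hn hu hml
    (P.I.mul_mem_right (u (hb l) ^ 4) (P.sq_mem c hc)))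
  rw [sub_add_cancel] at h5
  exact neg_mem_iff.1 h5

/-- For any isotropic `u`, the small vectors orthogonal to `u` have their Siegel transformation
in `N` after multiplication by the fourth power of a coordinate of `u`. -/
theorem pow_smul_mem (hN : IsAbove P N) (hn : 3 ≤ n) {u v : Theta n → R} (hu : Q u = 0)
    (hv : v ∈ smallVectors n P) (huv : polarForm u v = 0) (l : Hb n) :
    u (hb l) ^ 4 • v ∈ siegelSub u N := by
  -- Subtracting a multiple of `u` from `u_l v` makes the coordinate with index `l` vanish.
  set y : Theta n → R := u (hb l) • v - v (hb l) • u with hy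
  have hyl : y (hb l) = 0 := by simp [hy, mul_comm]
  have hys : y ∈ smallVectors n P :=
    sub_mem (Submodule.smul_mem _ _ hv) (smul_mem_smallVectors (hv.1 l) _)
  have hyu : polarForm y u = 0 := by
    rw [hy, polarForm_sub_left, polarForm_smul_left, polarForm_smul_left, polarForm_comm v, huv,
      polarForm_self, hu]
    ring
  have hsum : u (hb l) • y = ∑ k, y (hb k) • tangent u k l.swap +
      y zero • (u (hb l) • eZero - (2 * u zero) • e l.swap) := by
    have h1 : ∑ k, y (hb k) • tangent u k l.swap =
        u (hb l) • ∑ k, y (hb k) • e k - (∑ k, y (hb k) * u (hb k.swap)) • e l.swap := by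
      rw [Finset.smul_sum, Finset.sum_smul, ← Finset.sum_sub_distrib]
      refine Finset.sum_congr rfl fun k _ => ?_
      rw [tangent, Sum.swap_swap]
      module
    have h2 : ∑ k, y (hb k) * u (hb k.swap) = -(2 * (y zero * u zero)) :=
      eq_neg_of_add_eq_zero_left hyu
    rw [h1, h2]
    conv_lhs => rw [eq_sum_e y]
    module
  have hpy : u (hb l) ^ 2 • u (hb l) • y ∈ siegelSub u N := by
    rw [hsum, smul_add, Finset.smul_sum]
    refine add_mem (sum_mem fun k _ => ?_) ?_
    · rw [smul_smul]
      by_cases hk : k = l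
      · rw [hk, hyl, mul_zero, zero_smul]
        exact zero_mem _
      · by_cases hk' : k = l.swap
        · have : tangent u l.swap l.swap = 0 := by
            rw [tangent]
            module
          rw [hk', this, smul_zero]
          exact zero_mem _
        · exact hN.smul_tangent_mem hn hu (Apart.swap_right ⟨hk, hk'⟩)
            (P.I.mul_mem_left _ (hys.1 k))
    · rw [smul_smul, mul_comm]
      exact hN.smul_tangent_zero_mem hn hu l hys.2
  have hv' : u (hb l) ^ 4 • v = u (hb l) ^ 2 • u (hb l) • y + (u (hb l) ^ 3 * v (hb l)) • u := by
    rw [hy]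
    module
  rw [hv']
  exact add_mem hpy (smul_self_mem_siegelSub hu N _)

/-- If the `Θ_hb`-coordinates of the isotropic vector `u` generate the unit ideal, then the Siegel
transformation of every small vector orthogonal to `u` lies in `N`. -/
theorem mem_siegelSub_of_unimodular (hN : IsAbove P N) (hn : 3 ≤ n) {u v : Theta n → R}
    (hu : Q u = 0) (hspan : Ideal.span (Set.range fun i : Hb n => u (hb i)) = ⊤)
    (hv : v ∈ smallVectors n P) (huv : polarForm u v = 0) : v ∈ siegelSub u N := by
  have key : ∀ c ∈ Ideal.span ((· ^ 4) '' Set.range fun i : Hb n => u (hb i)),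
      ∀ v ∈ smallVectors n P, polarForm u v = 0 → c • v ∈ siegelSub u N := by
    intro c hc
    induction hc using Submodule.span_induction with
    | mem c hc =>
      obtain ⟨-, ⟨l, rfl⟩, rfl⟩ := hc
      exact fun v hv huv => hN.pow_smul_mem hn hu hv huv l
    | zero =>
      intro v _ _
      rw [zero_smul]
      exact zero_mem _
    | add c d _ _ hc hd =>
      intro v hv huv
      rw [add_smul]
      exact add_mem (hc v hv huv) (hd v hv huv)
    | smul a c _ hc =>
      intro v hv huv
      rw [smul_eq_mul, mul_comm, mul_smul]
      exact hc _ (Submodule.smul_mem _ a hv) (by rw [polarForm_smul_right, huv, mul_zero])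
  rw [← one_smul R v]
  refine key 1 ?_ v hv huv
  rw [Ideal.span_pow_eq_top _ hspan]
  exact Submodule.mem_top

end IsAbove

/-- The `Θ_hb`-coordinates of a column `σ e_i` generate the unit ideal: since the column is
isotropic, its coordinate with index `0` is nilpotent modulo the others. -/
theorem span_act_e (σ : orthogonal n R) (i : Hb n) :
    Ideal.span (Set.range fun k : Hb n => act σ (e i) (hb k)) = ⊤ := by
  set A := Ideal.span (Set.range fun k : Hb n => act σ (e i) (hb k)) with hA
  have hk : ∀ k, act σ (e i) (hb k) ∈ A := fun k => Ideal.subset_span ⟨k, rfl⟩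
  have h0 : act σ (e i) zero ^ 2 ∈ A := by
    have h := Q_act σ (e i)
    rw [Q_e, Q] at h
    rw [eq_neg_of_add_eq_zero_right h]
    exact neg_mem (sum_mem fun k _ => A.mul_mem_right _ (hk _))
  have h1 := polarForm_act σ (e i) (e i.swap)
  rw [polarForm_e_left, e_apply_self, polarForm] at h1
  set s := ∑ k : Hb n, act σ (e i) (hb k) * act σ (e i.swap) (hb k.swap) with hs
  have hsA : s ∈ A := sum_mem fun k _ => A.mul_mem_right _ (hk _)
  rw [Ideal.eq_top_iff_one]
  have h2 : (1 : R) = s * (2 - s) +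
      act σ (e i) zero ^ 2 * (4 * act σ (e i.swap) zero ^ 2) := by
    linear_combination (-(1 - s) - 2 * act σ (e i) zero * act σ (e i.swap) zero) * h1
  rw [h2]
  exact add_mem (A.mul_mem_right _ hsA) (A.mul_mem_right _ h0)

/-! ### The standard commutator formula -/

theorem act_sub_mem_smallVectors {P : AdmissiblePair R} {σ : orthogonal n R}
    (hσ : σ ∈ principalCongruence n P) (w : Theta n → R) :
    act σ w - w ∈ smallVectors n P := by
  have h : act σ w - w = (σ.1.1 - 1) *ᵥ w := by
    rw [Matrix.sub_mulVec, Matrix.one_mulVec, act_apply]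
  rw [h]
  refine ⟨fun i => ?_, ?_⟩
  · rw [Matrix.mulVec, dotProduct]
    exact sum_mem fun k _ => P.I.mul_mem_right (w k) (hσ.1 i k)
  · rw [Matrix.mulVec, dotProduct]
    exact sum_mem fun k _ => P.J.mul_mem_right (w k) (hσ.2 k)

theorem siegel_e_e_mem_elementary {i k : Hb n} (h : Apart i k) (x : R) :
    siegel (e i) (x • e k) ∈ elementary n R :=
  isAbove_elementary.siegel_e_e_mem h Submodule.mem_top

theorem siegel_e_eZero_mem_elementary (i : Hb n) (x : R) :
    siegel (e i) (x • eZero) ∈ elementary n R :=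
  isAbove_elementary.siegel_e_eZero_mem i Submodule.mem_top

/-- The transformation `T_j(1)` maps `e_{-j}` to `e_{-j} + e_0 - e_j`, so conjugation by it produces
transformations in the direction of `e_0` from those in the direction of `e_{-j}`. -/
theorem siegel_e_eZero_mem_of_conj {S : Subgroup (orthogonal n R)}
    (hS : ∀ ε ∈ elementary n R, ∀ σ ∈ S, ε * σ * ε⁻¹ ∈ S) {i j : Hb n} (h : Apart i j) {x : R}
    (h1 : siegel (e i) (x • e j) ∈ S) (h2 : siegel (e i) (x • e j.swap) ∈ S) :
    siegel (e i) (x • eZero) ∈ S := by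
  have hact : act (siegel (e j : Theta n → R) ((-1 : R) • eZero)) (e j.swap : Theta n → R) =
      e j.swap + eZero - e j := by
    rw [act_siegel (Q_e j) (by simp)]
    simp
  have h3 := hS _ (siegel_e_eZero_mem_elementary j (-1)) _ h2
  rw [siegel_conj, act_siegel_of_orthogonal (by simp [h.symm]) (by simp), map_smul, hact] at h3
  have h4 : (x • eZero : Theta n → R) =
      x • (e j.swap + eZero - e j) - x • e j.swap + x • e j := by
    module
  have h5 : x • eZero ∈ siegelSub (e i) S := by
    rw [h4]
    exact add_mem (sub_mem ⟨by simp [h], h3⟩ ⟨by simp [h], h2⟩) ⟨by simp [h], h1⟩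
  exact h5.2

/-- A subgroup normalized by `EO_{2n+1}(R)` contains `EO_{2n+1}(R)` as soon as it contains the short
root matrices. -/
theorem elementary_le_of_conj {S : Subgroup (orthogonal n R)} (hn : 3 ≤ n)
    (hS : ∀ ε ∈ elementary n R, ∀ σ ∈ S, ε * σ * ε⁻¹ ∈ S)
    (h : ∀ i k : Hb n, Apart i k → ∀ x : R, siegel (e i) (x • e k) ∈ S) : elementary n R ≤ S := by
  refine (Subgroup.closure_le _).2 (Set.union_subset ?_ ?_)
  · rintro - ⟨i, j, hij, x, rfl⟩
    rw [shortRoot_eq_siegel]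
    exact h i _ (Apart.swap_right hij) x
  · rintro - ⟨i, x, rfl⟩
    obtain ⟨j, hj, -⟩ := exists_apart hn i i
    rw [extraShortRoot_eq_siegel]
    exact siegel_e_eZero_mem_of_conj hS hj.symm (h i _ hj.symm _) (h i _ hj.symm.swap_right _)

namespace IsAbove

variable {P : AdmissiblePair R} {N : Subgroup (orthogonal n R)}

/-- Modulo `N`, commutators of elementary elements are not changed by factors from `N`. -/
theorem commutator_congr (hN : IsAbove P N) {g s a b : orthogonal n R} (hg : g ∈ elementary n R)
    (hs : s ∈ elementary n R) (ha : a ∈ N) (hbN : b ∈ N) :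
    a * g * (b * s) * (a * g)⁻¹ * (b * s)⁻¹ * (g * s * g⁻¹ * s⁻¹)⁻¹ ∈ N := by
  have h1 := hN.conj_mem g hg b hbN
  have h2 := hN.conj_mem (g * s * g⁻¹) (mul_mem (mul_mem hg hs) (inv_mem hg)) a⁻¹ (inv_mem ha)
  have h3 := hN.conj_mem (g * s * g⁻¹ * s⁻¹)
    (mul_mem (mul_mem (mul_mem hg hs) (inv_mem hg)) (inv_mem hs)) b⁻¹ (inv_mem hbN)
  have h4 := mul_mem (mul_mem (mul_mem ha h1) h2) h3
  convert h4 using 1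
  group

/-- The standard commutator formula for the conjugate of a short root matrix. -/
theorem commutator_siegel_e_e_mem (hN : IsAbove P N) (hn : 3 ≤ n) {σ : orthogonal n R}
    (hσ : σ ∈ principalCongruence n P) {i j : Hb n} (hij : Apart i j) (x : R) :
    σ * siegel (e i) (x • e j) * σ⁻¹ * (siegel (e i) (x • e j))⁻¹ ∈ N := by
  obtain ⟨m, hmi, hmj⟩ := exists_apart hn i j
  set u := act σ (e i) with hu
  have hu0 : Q u = 0 := by rw [hu, Q_act, Q_e]
  have hus : u - e i ∈ smallVectors n P := act_sub_mem_smallVectors hσ _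
  have hpI : u (hb i) - 1 ∈ P.I := by simpa using hus.1 i
  have hqI : u (hb j.swap) ∈ P.I := by simpa [hij] using hus.1 j.swap
  have hapart : Apart j i.swap := hij.symm.swap_right
  set f := tangent u j i.swap with hf
  have hf' : f = u (hb i) • e j + (-u (hb j.swap)) • e i.swap := by
    rw [hf, tangent, Sum.swap_swap]
  have hfe : f - e j ∈ smallVectors n P := by
    have : f - e j = (u (hb i) - 1) • e j + (-u (hb j.swap)) • e i.swap := by
      rw [hf']
      module
    rw [this]
    exact add_mem (smul_mem_smallVectors hpI _) (smul_mem_smallVectors (neg_mem hqI) _)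
  have hfu : polarForm u f = 0 := by rw [polarForm_comm, polarForm_tangent]
  -- Up to a factor in `N`, the conjugate `siegel u (x • σ e_j)` may be replaced by
  -- `siegel u (x • f)`, whose two arguments can be exchanged.
  have hd : x • (act σ (e j) - f) ∈ siegelSub u N := by
    refine hN.mem_siegelSub_of_unimodular hn hu0 (span_act_e σ i) (Submodule.smul_mem _ _ ?_) ?_
    · rw [← sub_sub_sub_cancel_right _ _ (e j)]
      exact sub_mem (act_sub_mem_smallVectors hσ _) hfe
    · rw [polarForm_smul_right, polarForm_sub_right, hfu, hu, polarForm_act]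
      simp [hij]
  have h1 : σ * siegel (e i) (x • e j) * σ⁻¹ =
      siegel u (x • (act σ (e j) - f)) * siegel u (x • f) := by
    rw [siegel_conj, ← siegel_add u hd.1 (by rw [polarForm_smul_right, hfu, mul_zero]), map_smul]
    congr 1
    module
  -- The part of `u` outside of the indices `i` and `-j` contributes a factor in `N`.
  set z : Theta n → R := u (hb i) • e i + u (hb j.swap) • e j.swap with hz
  have hzs : z - e i ∈ smallVectors n P := by
    have : z - e i = (u (hb i) - 1) • e i + u (hb j.swap) • e j.swap := by
      rw [hz]
      module
    rw [this]
    exact add_mem (smul_mem_smallVectors hpI _) (smul_mem_smallVectors hqI _)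
  have hfz : polarForm f z = 0 := by
    simp only [hf', hz, polarForm_add_left, polarForm_add_right, polarForm_smul_left,
      polarForm_smul_right, polarForm_e_left, Sum.swap_swap, e_apply_self, hij.e_apply_swap,
      hij.symm.e_swap_apply]
    ring
  have hr : x • (z - u) ∈ siegelSub f N := by
    refine hN.mem_siegelSub_pair hn hapart (Submodule.smul_mem _ _ ?_) ?_
    · rw [← sub_sub_sub_cancel_right _ _ (e i)]
      exact sub_mem hzs hus
    · change polarForm f _ = 0
      rw [polarForm_smul_right, polarForm_sub_right, hfz, polarForm_comm, hfu, sub_zero, mul_zero]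
  have h2 : siegel u (x • f) = siegel f (x • (z - u)) * siegel f (-(x • z)) := by
    rw [hf, siegel_smul_tangent hu0 hapart, ← siegel_add _ hr.1
      (by rw [polarForm_neg_right, polarForm_smul_right, hfz, mul_zero, neg_zero])]
    congr 1
    module
  -- Both `siegel f (-(x • z))` and `siegel (e j) (-(x • e i))` are commutators of transformations
  -- that agree modulo `N`.
  have hf0 : Q f = 0 := Q_tangent u hapart
  have hz0 : Q z = 0 := Q_pair hij.swap_right _ _
  have hfm : polarForm f (e m) = 0 := by simp [hf', hmi.symm, hmj.symm]
  have hmz : polarForm (e m.swap) z = 0 := by simp [hz, hmi, hmj]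
  have hzm : polarForm z (e m) = 0 := by simp [hz, hmi.symm, hmj.symm]
  have hfm' : polarForm (e m.swap) f = 0 := by simp [hf', hmi, hmj]
  have h3 : siegel f (-(x • z)) = siegel (e m.swap) z * siegel f (x • e m) *
      (siegel (e m.swap) z)⁻¹ * (siegel f (x • e m))⁻¹ := by
    rw [← siegel_act_sub (act_siegel_of_orthogonal hfm' (by rw [polarForm_comm, hfz]))
      (by rw [polarForm_smul_right, hfm, mul_zero]), map_smul, act_siegel (Q_e _) hmz, hz0, hzm]
    congr 1
    simp
    module
  have h4 : siegel (e j : Theta n → R) (-(x • e i)) =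
      siegel (e m.swap) (e i) * siegel (e j) (x • e m) *
        (siegel (e m.swap) (e i))⁻¹ * (siegel (e j) (x • e m))⁻¹ := by
    rw [← siegel_act_sub (act_siegel_of_orthogonal (by simp [hmj]) (by simp [hij]))
      (by simp [hmj.symm]), map_smul, act_siegel (Q_e _) (by simp [hmi])]
    congr 1
    simp [hmi.symm]
    module
  have h5 : siegel (e i : Theta n → R) (x • e j) = siegel (e j) (-(x • e i)) := by
    rw [siegel_swap (Q_e i) (by simp) (by simp [hij]), siegel_smul x (Q_e j) (by simp [hij.symm]),
      smul_neg]
  have h6 : siegel (e m.swap) z = siegel (e m.swap) (z - e i) * siegel (e m.swap) (e i) := by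
    rw [← siegel_add _ (by rw [polarForm_sub_right, hmz]; simp [hmi]) (by simp [hmi]),
      sub_add_cancel]
  have h6' : siegel (e m.swap) (z - e i) ∈ N := by
    refine (hN.mem_siegelSub_e_of_small ?_ hzs).2
    rw [← polarForm_e_left (z - e i), polarForm_sub_right, hmz]
    simp [hmi]
  have hswap : ∀ {a : Theta n → R}, Q a = 0 → polarForm (e m) a = 0 →
      siegel a (x • e m) = siegel (e m) (x • -a) := by
    intro a ha ham
    rw [siegel_swap ha (by simp) (by rw [polarForm_smul_right, polarForm_comm, ham, mul_zero]),
      siegel_smul x (Q_e m) (by rw [polarForm_neg_right, ham, neg_zero])]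
  have hmf : polarForm (e m) f = 0 := by rw [polarForm_comm, hfm]
  have hme : polarForm (e m) (e j : Theta n → R) = 0 := by simp [hmj]
  have h7 : siegel f (x • e m) = siegel (e m) (-x • (f - e j)) * siegel (e j) (x • e m) := by
    rw [hswap hf0 hmf, hswap (Q_e j) hme, ← siegel_add _
      (by rw [polarForm_smul_right, polarForm_sub_right, hmf, hme, sub_zero, mul_zero])
      (by rw [polarForm_smul_right, polarForm_neg_right, hme, neg_zero, mul_zero])]
    congr 1
    module
  have h7' : siegel (e m) (-x • (f - e j)) ∈ N := by
    refine (hN.mem_siegelSub_e_of_small ?_ (Submodule.smul_mem _ _ hfe)).2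
    rw [← polarForm_e_left (-x • _), polarForm_smul_right, polarForm_sub_right, hmf, hme, sub_zero,
      mul_zero]
  have h8 : siegel (e m.swap) (e i : Theta n → R) ∈ elementary n R := by
    simpa using siegel_e_e_mem_elementary hmi.swap_left (1 : R)
  have h9 := hN.commutator_congr h8 (siegel_e_e_mem_elementary hmj.symm x) h6' h7'
  rw [← h6, ← h7, ← h3, ← h4, ← h5] at h9
  rw [h1, h2, mul_assoc, mul_assoc]
  exact mul_mem hd.2 (mul_mem hr.2 h9)

/-- The standard commutator formula `[O_{2n+1}(R,I,J), EO_{2n+1}(R)] ≤ N`, for every subgroup `N`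
that contains `EO_{2n+1}(I,J)` and is normalized by `EO_{2n+1}(R)`. -/
theorem commutator_principalCongruence_mem (hN : IsAbove P N) (hn : 3 ≤ n) {σ ε : orthogonal n R}
    (hσ : σ ∈ principalCongruence n P) (hε : ε ∈ elementary n R) :
    σ * ε * σ⁻¹ * ε⁻¹ ∈ N := by
  let S : Subgroup (orthogonal n R) :=
    { carrier := {ε | ε ∈ elementary n R ∧ ∀ σ ∈ principalCongruence n P, σ * ε * σ⁻¹ * ε⁻¹ ∈ N}
      one_mem' := ⟨one_mem _, fun σ _ => by simp⟩
      mul_mem' := by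
        rintro ε δ ⟨hε, hε'⟩ ⟨hδ, hδ'⟩
        refine ⟨mul_mem hε hδ, fun σ hσ => ?_⟩
        convert mul_mem (hε' σ hσ) (hN.conj_mem ε hε _ (hδ' σ hσ)) using 1
        group
      inv_mem' := by
        rintro ε ⟨hε, hε'⟩
        refine ⟨inv_mem hε, fun σ hσ => ?_⟩
        convert hN.conj_mem ε⁻¹ (inv_mem hε) _ (inv_mem (hε' σ hσ)) using 1
        group }
  have hS : elementary n R ≤ S := by
    refine elementary_le_of_conj hn ?_ fun i k h x =>
      ⟨siegel_e_e_mem_elementary h x, fun σ hσ => hN.commutator_siegel_e_e_mem hn hσ h x⟩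
    rintro δ hδ ε ⟨hε, hε'⟩
    refine ⟨mul_mem (mul_mem hδ hε) (inv_mem hδ), fun σ hσ => ?_⟩
    have h := (principalCongruence_normal n P).conj_mem σ hσ δ⁻¹
    convert hN.conj_mem δ hδ _ (hε' _ h) using 1
    group
  exact (hS hε).2 σ hσ

end IsAbove

/-! ### Relative elementary subgroups and full congruence subgroups -/

theorem conj_mem_map_normalClosure {G : Type*} [Group G] (K : Subgroup G) (S : Set K) {g x : G}
    (hg : g ∈ K) (hx : x ∈ (Subgroup.normalClosure S).map K.subtype) :
    g * x * g⁻¹ ∈ (Subgroup.normalClosure S).map K.subtype := by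
  obtain ⟨y, hy, rfl⟩ := hx
  exact ⟨⟨g, hg⟩ * y * ⟨g, hg⟩⁻¹, Subgroup.normalClosure_normal.conj_mem y hy _, rfl⟩

theorem le_map_normalClosure {G : Type*} [Group G] {K L : Subgroup G} (hL : L ≤ K) :
    L ≤ (Subgroup.normalClosure (L.subgroupOf K : Set K)).map K.subtype :=
  fun x hx => ⟨⟨x, hL hx⟩, Subgroup.subset_normalClosure hx, rfl⟩

theorem map_normalClosure_le {G : Type*} [Group G] {K L H : Subgroup G} (hL : L ≤ H)
    (hH : ∀ g ∈ K, ∀ x ∈ H, g * x * g⁻¹ ∈ H) :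
    (Subgroup.normalClosure (L.subgroupOf K : Set K)).map K.subtype ≤ H := by
  have : (H.comap K.subtype).Normal := ⟨fun x hx g => hH g g.2 x hx⟩
  exact Subgroup.map_le_iff_le_comap.2 (Subgroup.normalClosure_le_normal fun x hx => hL hx)

theorem isAbove_relElementary (P : AdmissiblePair R) : IsAbove P (relElementary n P) where
  conj_mem _ hε _ hσ := conj_mem_map_normalClosure _ _ hε hσ
  le := le_map_normalClosure (preElementary_le_elementary n P)

theorem IsAbove.relElementary_le {P : AdmissiblePair R} {H : Subgroup (orthogonal n R)}
    (hH : IsAbove P H) : relElementary n P ≤ H :=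
  map_normalClosure_le hH.le hH.conj_mem

/-- `EO_{2n+1}(R)` is normal in `O_{2n+1}(R)`: the standard commutator formula for the pair
`(R, R)`. -/
theorem conj_mem_elementary (hn : 3 ≤ n) (σ : orthogonal n R) {ε : orthogonal n R}
    (hε : ε ∈ elementary n R) : σ * ε * σ⁻¹ ∈ elementary n R := by
  have hσ : σ ∈ principalCongruence n (topPair R) :=
    ⟨fun _ _ => Submodule.mem_top, fun _ => Submodule.mem_top⟩
  simpa using mul_mem (isAbove_elementary.commutator_principalCongruence_mem hn hσ hε) hε

theorem siegel_e_e_eq_commutator {i k m : Hb n} (hik : Apart i k) (him : Apart i m)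
    (hkm : Apart k m) (x r : R) :
    siegel (e i : Theta n → R) ((x * r) • e k) =
      siegel (e k) (r • e m.swap) * siegel (e i) (x • e m) *
        (siegel (e k) (r • e m.swap))⁻¹ * (siegel (e i) (x • e m))⁻¹ := by
  rw [← siegel_act_sub (act_siegel_of_orthogonal (by simp [hik.symm]) (by simp [him.symm]))
    (by simp [him]), map_smul, act_siegel (Q_e k) (by simp [hkm])]
  congr 1
  simp [hkm]
  module

/-- `[CO_{2n+1}(R,I,J), EO_{2n+1}(R)] ≤ N`. For `h` in the full congruence subgroup, commutation
with `h` is a homomorphism from `EO_{2n+1}(R)` to a central subgroup of `EO_{2n+1}(R)` modulo `N`,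
so it kills commutators, which generate `EO_{2n+1}(R)`. -/
theorem IsAbove.commutator_fullCongruence_mem {P : AdmissiblePair R}
    {N : Subgroup (orthogonal n R)} (hN : IsAbove P N) (hn : 3 ≤ n) {h ε : orthogonal n R}
    (hh : h ∈ fullCongruence n P) (hε : ε ∈ elementary n R) : h * ε * h⁻¹ * ε⁻¹ ∈ N := by
  let S : Subgroup (orthogonal n R) :=
    { carrier := {ε | ε ∈ elementary n R ∧ h * ε * h⁻¹ * ε⁻¹ ∈ N}
      one_mem' := ⟨one_mem _, by simp⟩
      mul_mem' := by
        rintro ε δ ⟨hε, hε'⟩ ⟨hδ, hδ'⟩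
        refine ⟨mul_mem hε hδ, ?_⟩
        convert mul_mem hε' (hN.conj_mem ε hε _ hδ') using 1
        group
      inv_mem' := by
        rintro ε ⟨hε, hε'⟩
        refine ⟨inv_mem hε, ?_⟩
        convert hN.conj_mem ε⁻¹ (inv_mem hε) _ (inv_mem hε') using 1
        group }
  have hcomm : ∀ ε ∈ elementary n R, ∀ δ ∈ elementary n R, ε * δ * ε⁻¹ * δ⁻¹ ∈ S := by
    intro ε hε δ hδ
    have hεδ : ε * δ * ε⁻¹ * δ⁻¹ ∈ elementary n R :=
      mul_mem (mul_mem (mul_mem hε hδ) (inv_mem hε)) (inv_mem hδ)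
    refine ⟨hεδ, ?_⟩
    set a := h * ε * h⁻¹ * ε⁻¹ with ha_def
    set b := h * δ * h⁻¹ * δ⁻¹ with hb_def
    have haP : a ∈ principalCongruence n P := hh ε hε
    have hbP : b ∈ principalCongruence n P := hh δ hδ
    have hbE : b ∈ elementary n R := mul_mem (conj_mem_elementary hn h hδ) (inv_mem hδ)
    have h1 := hN.commutator_principalCongruence_mem hn haP
      (mul_mem (mul_mem (mul_mem hε hbE) hδ) (inv_mem hε))
    have h2 := hN.commutator_principalCongruence_mem hn hbP hε
    have h3 := hN.commutator_principalCongruence_mem hn hbP hεδ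
    convert mul_mem (mul_mem h1 (inv_mem h2)) h3 using 1
    rw [ha_def, hb_def]
    group
  have hS : elementary n R ≤ S := by
    refine elementary_le_of_conj hn ?_ ?_
    · rintro δ hδ ε hε
      simpa using mul_mem (hcomm δ hδ ε hε.1) hε
    · intro i k hik x
      obtain ⟨m, hmi, hmk⟩ := exists_apart hn i k
      rw [← mul_one x, siegel_e_e_eq_commutator hik hmi.symm hmk.symm]
      exact hcomm _ (siegel_e_e_mem_elementary hmk.symm.swap_right 1) _
        (siegel_e_e_mem_elementary hmi.symm x)
  exact (hS hε).2

/-! ### The level of a subgroup normalized by the elementary group -/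

/-- `H` is normalized by `EO_{2n+1}(R)`. -/
def IsENormal (H : Subgroup (orthogonal n R)) : Prop :=
  ∀ ε ∈ elementary n R, ∀ σ ∈ H, ε * σ * ε⁻¹ ∈ H

namespace IsENormal

variable {H : Subgroup (orthogonal n R)}

theorem commutator_mem (hH : IsENormal H) {ε σ : orthogonal n R} (hε : ε ∈ elementary n R)
    (hσ : σ ∈ H) : ε * σ * ε⁻¹ * σ⁻¹ ∈ H :=
  mul_mem (hH ε hε σ hσ) (inv_mem hσ)

theorem commutator_mem' (hH : IsENormal H) {σ ε : orthogonal n R} (hσ : σ ∈ H)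
    (hε : ε ∈ elementary n R) : σ * ε * σ⁻¹ * ε⁻¹ ∈ H := by
  simpa [mul_assoc] using inv_mem (hH.commutator_mem hε hσ)

theorem act_sub_mem (hH : IsENormal H) {g : orthogonal n R} {u v : Theta n → R}
    (hg : g ∈ elementary n R) (hgu : act g u = u) (hv : v ∈ siegelSub u H) :
    act g v - v ∈ siegelSub u H := by
  refine ⟨?_, by rw [siegel_act_sub hgu hv.1]; exact hH.commutator_mem hg hv.2⟩
  have h : polarForm u (act g v) = 0 := by rw [← hgu, polarForm_act, hv.1]
  rw [polarForm_sub_right, h, hv.1, sub_zero]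

theorem siegel_e_e_mem_smul (hH : IsENormal H) {i k m : Hb n} (hik : Apart i k) (him : Apart i m)
    (hkm : Apart k m) {x : R} (hx : siegel (e i) (x • e m) ∈ H) (r : R) :
    siegel (e i) ((x * r) • e k) ∈ H := by
  rw [siegel_e_e_eq_commutator hik him hkm]
  exact hH.commutator_mem (siegel_e_e_mem_elementary hkm.swap_right r) hx

theorem siegel_e_e_swap {i k : Hb n} (h : Apart i k) {x : R} (hx : siegel (e i) (x • e k) ∈ H) :
    siegel (e k) (x • e i) ∈ H := by
  rw [siegel_swap (Q_e i) (by simp) (by simp [h]), siegel_smul x (Q_e k) (by simp [h.symm]),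
    smul_neg, siegel_neg _ (by simp [h.symm])] at hx
  exact inv_mem_iff.1 hx

theorem siegel_e_e_mem_of_mem (hH : IsENormal H) (hn : 3 ≤ n) {i m k l : Hb n} (him : Apart i m)
    {x : R} (hx : siegel (e i) (x • e m) ∈ H) (hkl : Apart k l) :
    siegel (e k) (x • e l) ∈ H := by
  have move : ∀ {i m k : Hb n}, Apart i m → Apart i k → siegel (e i) (x • e m) ∈ H →
      siegel (e i) (x • e k) ∈ H := by
    have step : ∀ {i m k : Hb n}, Apart i m → Apart i k → Apart k m →
        siegel (e i) (x • e m) ∈ H → siegel (e i) (x • e k) ∈ H := by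
      intro i m k him hik hkm hx
      simpa using hH.siegel_e_e_mem_smul hik him hkm hx 1
    intro i m k him hik hx
    by_cases hkm : Apart k m
    · exact step him hik hkm hx
    · obtain ⟨p, hpi, hpm⟩ := exists_apart hn i m
      have hpk : Apart p k := by
        rw [apart_iff, not_not] at hkm
        rwa [apart_iff, hkm, ← apart_iff]
      exact step hpi.symm hik hpk.symm (step him hpi.symm hpm hx)
  obtain ⟨p, hpk, hpi⟩ := exists_apart hn k i
  exact move hpk.symm hkl (siegel_e_e_swap hpk (move hpi hpk (siegel_e_e_swap hpi.symm
    (move him hpi.symm hx))))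

/-- A product of two short root matrices maps `e_i` to `e_j` and fixes `e_0`, so it transports the
transformations along `e_i` to those along `e_j`. -/
theorem siegel_e_eZero_mem_of_mem (hH : IsENormal H) (hn : 3 ≤ n) {i : Hb n} {x : R}
    (hx : siegel (e i) (x • eZero) ∈ H) (j : Hb n) : siegel (e j) (x • eZero) ∈ H := by
  have step : ∀ {i j : Hb n}, Apart i j → siegel (e i) (x • eZero) ∈ H →
      siegel (e j) (x • eZero) ∈ H := by
    intro i j hij hx
    have h1 : act (siegel (e j) ((1 : R) • e i.swap)) (e i : Theta n → R) = e i + e j := by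
      rw [act_siegel (Q_e j) (by simp [hij.symm])]
      simp [hij.symm]
    have h2 : act (siegel (e i) ((-1 : R) • e j.swap)) (e i + e j : Theta n → R) = e j := by
      rw [act_siegel (Q_e i) (by simp [hij])]
      simp [hij, hij.symm]
    have h3 := hH _ (siegel_e_e_mem_elementary hij.swap_right (-1)) _
      (hH _ (siegel_e_e_mem_elementary hij.symm.swap_right 1) _ hx)
    rwa [siegel_conj, siegel_conj, h1, h2, map_smul, map_smul,
      act_siegel_of_orthogonal (a := e j) (by simp) (by simp),
      act_siegel_of_orthogonal (by simp) (by simp)] at h3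
  obtain ⟨m, hmi, hmj⟩ := exists_apart hn i j
  exact step hmj (step hmi.symm hx)

/-- Conjugation by `T_{j,i}(r)` replaces `e_i` by `e_i + r e_j`; since `e_0` is not isotropic, the
transformation along this sum has the additional factor `siegel e_i (x² r e_j)`. -/
theorem siegel_e_eZero_add_mem (hH : IsENormal H) {i j : Hb n} (hij : Apart i j) {x : R}
    (hx : siegel (e i) (x • eZero) ∈ H) (r : R) :
    siegel (e j) ((x * r) • eZero) * siegel (e i) ((x ^ 2 * r) • e j) ∈ H := by
  have h := hH _ (siegel_e_e_mem_elementary hij.symm.swap_right r) _ hx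
  have h1 : act (siegel (e j : Theta n → R) (r • e i.swap)) (e i) = e i + r • e j := by
    rw [act_siegel (Q_e j) (by simp [hij.symm])]
    simp [hij.symm]
  rw [siegel_conj, h1, map_smul, act_siegel_of_orthogonal (by simp) (by simp),
    siegel_add_left (Q_e i) (by simp) (by simp [hij]) (by simp) (by simp),
    siegel_smul r (Q_e j) (by simp), Q_smul, Q_eZero, smul_smul, smul_smul, mul_one,
    mul_comm r x, mul_assoc] at h
  exact (mul_mem_cancel_left hx).1 h

theorem siegel_e_sq_mem (hH : IsENormal H) (hn : 3 ≤ n) {i j : Hb n} (hij : Apart i j) {x : R}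
    (hx : siegel (e i) (x • eZero) ∈ H) : siegel (e i) (x ^ 2 • e j) ∈ H := by
  have h := hH.siegel_e_eZero_add_mem hij hx 1
  rw [mul_one, mul_one] at h
  exact (mul_mem_cancel_left (hH.siegel_e_eZero_mem_of_mem hn hx j)).1 h

/-- The level of a subgroup `H` normalized by `EO_{2n+1}(R)`: the pair consisting of the ideal of
all `x` such that the `T_{ij}(x)` lie in `H`, and the ideal of all `x` such that the `T_i(x)` lie
in `H`. -/
def level (hH : IsENormal H) (hn : 3 ≤ n) : AdmissiblePair R where
  I :=
    { carrier := {x | ∀ i k : Hb n, Apart i k → siegel (e i) (x • e k) ∈ H}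
      zero_mem' := by
        intro i k _
        rw [zero_smul, siegel_zero]
        exact one_mem H
      add_mem' := by
        intro x y hx hy i k h
        rw [add_smul, siegel_add _ (by simp [h]) (by simp [h])]
        exact mul_mem (hx i k h) (hy i k h)
      smul_mem' := by
        intro r x hx i k h
        obtain ⟨m, hmi, hmk⟩ := exists_apart hn i k
        rw [smul_eq_mul, mul_comm]
        exact hH.siegel_e_e_mem_smul h hmi.symm hmk.symm (hx i m hmi.symm) r }
  J :=
    { carrier := {x | ∀ i : Hb n, siegel (e i) (x • eZero) ∈ H}
      zero_mem' := by
        intro i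
        rw [zero_smul, siegel_zero]
        exact one_mem H
      add_mem' := by
        intro x y hx hy i
        rw [add_smul, siegel_add _ (by simp) (by simp)]
        exact mul_mem (hx i) (hy i)
      smul_mem' := by
        intro r x hx i
        obtain ⟨m, hmi, -⟩ := exists_apart hn i i
        obtain ⟨p, hpm, hpi⟩ := exists_apart hn m i
        have h := hH.siegel_e_eZero_add_mem hmi (hx m) r
        have h1 : siegel (e m) (x ^ 2 • e p) ∈ H := hH.siegel_e_sq_mem hn hpm.symm (hx m)
        rw [smul_eq_mul, mul_comm]
        exact (mul_mem_cancel_right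
          (hH.siegel_e_e_mem_smul hmi hpm.symm hpi.symm h1 r)).1 h }
  two_mul_mem := by
    intro x hx i k h
    have h1 := hH.act_sub_mem (siegel_e_eZero_mem_elementary k (-1))
      (act_siegel_of_orthogonal (by simp [h.symm]) (by simp)) ⟨by simp, hx i⟩
    rw [map_smul, act_siegel (Q_e k) (by simp)] at h1
    have h2 := (neg_mem h1).2
    convert h2 using 2
    simp
    module
  sq_mem := fun x hx i k h => hH.siegel_e_sq_mem hn h (hx i)
  le := by
    intro x hx i
    obtain ⟨m, hmi, -⟩ := exists_apart hn i i
    exact siegel_e_eZero_mem_of_conj hH hmi.symm (hx i m hmi.symm) (hx i _ hmi.symm.swap_right)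

theorem mem_level_I (hH : IsENormal H) (hn : 3 ≤ n) {i m : Hb n} (h : Apart i m) {x : R}
    (hx : siegel (e i) (x • e m) ∈ H) : x ∈ (hH.level hn).I :=
  fun _ _ hkl => hH.siegel_e_e_mem_of_mem hn h hx hkl

theorem mem_level_J (hH : IsENormal H) (hn : 3 ≤ n) {i : Hb n} {x : R}
    (hx : siegel (e i) (x • eZero) ∈ H) : x ∈ (hH.level hn).J :=
  fun j => hH.siegel_e_eZero_mem_of_mem hn hx j

theorem isAbove_level (hH : IsENormal H) (hn : 3 ≤ n) : IsAbove (hH.level hn) H where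
  conj_mem := hH
  le := by
    refine (Subgroup.closure_le _).2 (Set.union_subset ?_ ?_)
    · rintro - ⟨i, j, hij, x, hx, rfl⟩
      rw [shortRoot_eq_siegel]
      exact hx i _ (Apart.swap_right hij)
    · rintro - ⟨i, x, hx, rfl⟩
      rw [extraShortRoot_eq_siegel]
      exact (hH.level hn).J.neg_mem hx i

/-- Two successive commutators single out one coordinate of `y`. -/
theorem apply_mem_level_I (hH : IsENormal H) (hn : 3 ≤ n) {i k : Hb n} (hik : Apart i k)
    {y : Theta n → R} (hy : y ∈ siegelSub (e i) H) : y (hb k) ∈ (hH.level hn).I := by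
  obtain ⟨m, hmi, hmk⟩ := exists_apart hn i k
  have hg : siegel (e k.swap) (e m : Theta n → R) ∈ elementary n R := by
    simpa using siegel_e_e_mem_elementary hmk.symm.swap_left (1 : R)
  have hg' : siegel (e k.swap) (e m.swap : Theta n → R) ∈ elementary n R := by
    simpa using siegel_e_e_mem_elementary hmk.symm.swap_left.swap_right (1 : R)
  have h1 := hH.act_sub_mem hg
    (act_siegel_of_orthogonal (by simp [hik.symm]) (by simp [hmi])) hy
  have h2 := hH.act_sub_mem hg'
    (act_siegel_of_orthogonal (by simp [hik.symm]) (by simp [hmi])) h1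
  rw [act_siegel (Q_e _) (by simp [hmk.symm]), act_siegel (Q_e _) (by simp [hmk.symm])] at h2
  refine hH.mem_level_I hn hik.swap_right ?_
  have h3 := (neg_mem h2).2
  convert h3 using 2
  simp [hmk, hmk.symm]

theorem apply_mem_level_J (hH : IsENormal H) (hn : 3 ≤ n) {i : Hb n}
    {y : Theta n → R} (hy : y ∈ siegelSub (e i) H) : y zero ∈ (hH.level hn).J := by
  have h1 : y - y zero • eZero ∈ siegelSub (e i) H := by
    refine (hH.isAbove_level hn).mem_siegelSub_e ?_ (fun k hk => ?_) (by simp)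
    · simpa using hy.1
    · simpa using hH.apply_mem_level_I hn hk hy
  have h2 := sub_mem hy h1
  rw [sub_sub_cancel] at h2
  exact hH.mem_level_J hn h2.2

end IsENormal

/-! ### Extraction of the matrix coefficients -/

theorem act_conj_apply (σ ε : orthogonal n R) (w : Theta n → R) (j : Hb n) :
    act (ε⁻¹ * σ * ε) w (hb j) = polarForm (act ε (e j.swap)) (act σ (act ε w)) := by
  rw [act_mul, act_mul, ← polarForm_act ε⁻¹, act_inv_act, polarForm_e_left, Sum.swap_swap]

/-- The element `siegel e_b (u_i e_c) * siegel e_{-i} (u_{-c} e_b - u_{-b} e_c)`. It corresponds to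
the bivector obtained by contracting `e_{-i} ∧ e_b ∧ e_c` with `u`, and therefore fixes `u`. -/
noncomputable def stabilizing (u : Theta n → R) (i b c : Hb n) : orthogonal n R :=
  siegel (e b) (u (hb i) • e c) * siegel (e i.swap) (tangent u b c)

theorem act_stabilizing_right {i b c : Hb n} (hib : Apart i b) (hic : Apart i c) (hbc : Apart b c)
    (u w : Theta n → R) : act (siegel (e i.swap) (tangent u b c)) w =
      w + polarForm (tangent u b c) w • e i.swap - w (hb i) • tangent u b c := by
  rw [act_siegel (Q_e _) (by simp [tangent, hib, hic]), Q_tangent u hbc]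
  simp

theorem act_stabilizing_left {b c : Hb n} (hbc : Apart b c) (x : R) (w : Theta n → R) :
    act (siegel (e b) (x • e c)) w =
      w + (x * w (hb c.swap)) • e b - (x * w (hb b.swap)) • e c := by
  rw [act_siegel (Q_e _) (by simp [hbc])]
  simp [smul_smul, mul_comm]

theorem act_stabilizing {i b c : Hb n} (hib : Apart i b) (hic : Apart i c) (hbc : Apart b c)
    (u w : Theta n → R) : act (stabilizing u i b c) w =
      w + polarForm (tangent u b c) w • e i.swap - w (hb i) • tangent u b c +
        (u (hb i) * w (hb c.swap)) • e b - (u (hb i) * w (hb b.swap)) • e c := by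
  rw [stabilizing, act_mul, act_stabilizing_right hib hic hbc, act_stabilizing_left hbc]
  simp [tangent, hib, hic, hbc, hbc.symm]

theorem act_stabilizing_self {i b c : Hb n} (hib : Apart i b) (hic : Apart i c) (hbc : Apart b c)
    (u : Theta n → R) : act (stabilizing u i b c) u = u := by
  rw [act_stabilizing hib hic hbc, polarForm_tangent, tangent]
  module

theorem tangent_mem_siegelSub_e_elementary {i b c : Hb n} (hib : Apart i b) (hic : Apart i c)
    (u : Theta n → R) : siegel (e i.swap) (tangent u b c) ∈ elementary n R :=
  (isAbove_elementary.mem_siegelSub_e (by simp [tangent, hib.symm, hic.symm])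
    (fun _ _ => Submodule.mem_top) Submodule.mem_top).2

theorem stabilizing_mem_elementary {i b c : Hb n} (hib : Apart i b) (hic : Apart i c)
    (hbc : Apart b c) (u : Theta n → R) : stabilizing u i b c ∈ elementary n R :=
  mul_mem (siegel_e_e_mem_elementary hbc _) (tangent_mem_siegelSub_e_elementary hib hic u)

namespace IsENormal

variable {H : Subgroup (orthogonal n R)}

theorem inv_mul_conj_mem (hH : IsENormal H) {σ τ : orthogonal n R} (hσ : σ ∈ H)
    (hτ : τ ∈ elementary n R) : σ⁻¹ * τ * σ * τ⁻¹ ∈ H := by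
  simpa [mul_assoc] using mul_mem (inv_mem hσ) (hH τ hτ σ hσ)

/-- If `τ` fixes the column `σ e_i` of an element `σ` of `H`, then `h = σ⁻¹ τ σ` fixes `e_i`, and
modulo `H` it acts by conjugation on the transformations along `e_i` as `τ` does. -/
theorem siegel_mul_inv_mem (hH : IsENormal H) {σ τ : orthogonal n R} (hσ : σ ∈ H)
    (hτ : τ ∈ elementary n R) {i : Hb n} (hfix : act τ (act σ (e i)) = act σ (e i))
    {z : Theta n → R} (hz : siegel (e i) z ∈ elementary n R) :
    siegel (e i) (act (σ⁻¹ * τ * σ) z) * (τ * siegel (e i) z * τ⁻¹)⁻¹ ∈ H := by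
  have h1 : act (σ⁻¹ * τ * σ) (e i) = e i := by
    rw [act_mul, act_mul, hfix, act_inv_act]
  have h2 := hH.commutator_mem' (hH.inv_mul_conj_mem hσ hτ)
    (mul_mem (mul_mem hτ hz) (inv_mem hτ))
  have h3 := siegel_conj (σ⁻¹ * τ * σ) (e i) z
  rw [h1] at h3
  rw [← h3]
  convert h2 using 1
  group

/-- In the situation of `siegel_mul_inv_mem`, the conjugate by `τ` of a transformation along `e_i`
commutes modulo `H` with all transformations along `e_i`, because these commute with each other. -/
theorem commutator_siegel_mem (hH : IsENormal H) {σ τ : orthogonal n R} (hσ : σ ∈ H)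
    (hτ : τ ∈ elementary n R) {i : Hb n} (hfix : act τ (act σ (e i)) = act σ (e i))
    {z z' : Theta n → R} (hz : siegel (e i) z ∈ elementary n R) (hz0 : polarForm (e i) z = 0)
    (hz' : siegel (e i) z' ∈ elementary n R) (hz0' : polarForm (e i) z' = 0) :
    τ * siegel (e i) z * τ⁻¹ * siegel (e i) z' * (τ * siegel (e i) z * τ⁻¹)⁻¹ *
      (siegel (e i) z')⁻¹ ∈ H := by
  have h1 : act (σ⁻¹ * τ * σ) (e i) = e i := by
    rw [act_mul, act_mul, hfix, act_inv_act]
  have h2 : polarForm (e i) (act (σ⁻¹ * τ * σ) z) = 0 := by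
    rw [← hz0, ← polarForm_act (σ⁻¹ * τ * σ) (e i) z, h1]
  have hk := hH.siegel_mul_inv_mem hσ hτ hfix hz
  set A := siegel (e i) (act (σ⁻¹ * τ * σ) z) with hA
  set B := τ * siegel (e i) z * τ⁻¹ with hB
  set C := siegel (e i) z' with hC
  have hAC : A * C = C * A := by
    rw [hA, hC, ← siegel_add _ h2 hz0', ← siegel_add _ hz0' h2, add_comm]
  have h3 := mul_mem (inv_mem hk) (hH C hz' _ hk)
  have h4 : (A * B⁻¹)⁻¹ * (C * (A * B⁻¹) * C⁻¹) = B * C * B⁻¹ * C⁻¹ := by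
    calc (A * B⁻¹)⁻¹ * (C * (A * B⁻¹) * C⁻¹) = B * A⁻¹ * (C * A) * B⁻¹ * C⁻¹ := by group
      _ = B * C * B⁻¹ * C⁻¹ := by
        rw [← hAC]
        group
  rwa [h4] at h3

/-- The commutator of `commutator_siegel_mem` for `z = e_b` and `z' = e_{-b}` equals
`siegel e_i (u_{-b} e_c)`, where `u = σ e_i`. -/
theorem coeff_apart_mem (hH : IsENormal H) (hn : 3 ≤ n) {σ : orthogonal n R} (hσ : σ ∈ H)
    {i j : Hb n} (hij : Apart i j) : act σ (e i) (hb j) ∈ (hH.level hn).I := by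
  obtain ⟨c, hci, hcj⟩ := exists_apart hn i j
  obtain ⟨b, rfl⟩ : ∃ b : Hb n, j = b.swap := ⟨j.swap, by rw [Sum.swap_swap]⟩
  have hib : Apart i b := by simpa using hij.swap_right
  have hbc : Apart b c := by simpa using hcj.swap_right.symm
  have hic : Apart i c := hci.symm
  set u := act σ (e i) with hu
  have h1 : siegel (e i) (e b : Theta n → R) ∈ elementary n R := by
    simpa using siegel_e_e_mem_elementary hib (1 : R)
  have h2 : siegel (e i) (e b.swap : Theta n → R) ∈ elementary n R := by
    simpa using siegel_e_e_mem_elementary hij (1 : R)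
  have h3 := hH.commutator_siegel_mem hσ (stabilizing_mem_elementary hib hic hbc u)
    (act_stabilizing_self hib hic hbc u) h1 (by simp [hib]) h2 (by simp [hib])
  have h4 : act (stabilizing u i b c) (e b) = e b := by
    rw [act_stabilizing hib hic hbc]
    simp [tangent, hib.symm, hbc, hbc.symm]
  have h5 : act (stabilizing u i b c) (e i) = e i - tangent u b c := by
    rw [act_stabilizing hib hic hbc]
    simp [tangent, hib, hic, hib.symm, hic.symm]
  have h6 : polarForm (e i - tangent u b c) (e b) = 0 := by
    simp [tangent, hib, hbc.symm]
  have h7 : polarForm (e i) (tangent u b c) = 0 := by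
    simp [tangent, hib, hic]
  have h8 : Q (e i - tangent u b c) = 0 := by
    rw [Q_sub, Q_e, Q_tangent u hbc, h7]
    ring
  have h10 := siegel_conj (stabilizing u i b c) (e i) (e b)
  rw [h4, h5] at h10
  rw [h10, ← siegel_act_sub (by
      refine act_siegel_of_orthogonal ?_ (by simp [hib.symm])
      rw [polarForm_sub_left, polarForm_comm (tangent u b c), h7]
      simp) (by simp [hib])] at h3
  have h9 : act (siegel (e i - tangent u b c) (e b)) (e b.swap) - e b.swap =
      (1 : R) • e i + u (hb b.swap) • e c := by
    rw [act_siegel h8 h6]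
    simp [tangent, hib, hbc.symm]
    module
  rw [h9, siegel_add _ (by simp) (by simp [hic]), siegel_self, one_mul] at h3
  exact hH.mem_level_I hn hic h3

/-- The coefficient with index `(j, i)` of `ε⁻¹ σ ε`, written by means of the polar form. -/
theorem conj_coeff_apart_mem (hH : IsENormal H) (hn : 3 ≤ n) {σ ε : orthogonal n R} (hσ : σ ∈ H)
    (hε : ε ∈ elementary n R) {i j : Hb n} (hij : Apart i j) :
    polarForm (act ε (e j.swap)) (act σ (act ε (e i))) ∈ (hH.level hn).I := by
  rw [← act_conj_apply]
  have h := hH ε⁻¹ (inv_mem hε) σ hσ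
  rw [inv_inv] at h
  exact hH.coeff_apart_mem hn h hij

theorem coeff_swap_mem (hH : IsENormal H) (hn : 3 ≤ n) {σ : orthogonal n R} (hσ : σ ∈ H)
    (i : Hb n) : act σ (e i) (hb i.swap) ∈ (hH.level hn).I := by
  obtain ⟨j, hj, -⟩ := exists_apart hn i i
  -- The conjugating matrix fixes `e i` and maps `e j.swap` to `e j.swap + e i`.
  have h := hH.conj_coeff_apart_mem hn hσ (siegel_e_e_mem_elementary hj.symm 1) hj.symm
  rw [act_siegel (Q_e i) (by simp [hj.symm]), act_siegel (Q_e i) (by simp [hj.symm])] at h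
  simp [hj, hj.symm] at h
  exact (Submodule.add_mem_iff_right _ (hH.coeff_apart_mem hn hσ hj.symm)).1 h

theorem coeff_mem (hH : IsENormal H) (hn : 3 ≤ n) {σ : orthogonal n R} (hσ : σ ∈ H)
    {i j : Hb n} (hij : i ≠ j) : act σ (e i) (hb j) ∈ (hH.level hn).I := by
  by_cases h : i = j.swap
  · obtain rfl : j = i.swap := by rw [h, Sum.swap_swap]
    exact hH.coeff_swap_mem hn hσ i
  · exact hH.coeff_apart_mem hn hσ ⟨hij, h⟩

theorem coeff_sub_coeff_mem (hH : IsENormal H) (hn : 3 ≤ n) {σ : orthogonal n R} (hσ : σ ∈ H)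
    (i j : Hb n) : act σ (e i) (hb i) - act σ (e j) (hb j) ∈ (hH.level hn).I := by
  have key : ∀ {i j : Hb n}, Apart i j →
      act σ (e i) (hb i) - act σ (e j) (hb j) ∈ (hH.level hn).I := by
    intro i j hij
    -- The conjugating matrix maps `e i` to `e i + e j` and `e j.swap` to `e j.swap - e i.swap`.
    have h := hH.conj_coeff_apart_mem hn hσ (siegel_e_e_mem_elementary hij.symm.swap_right 1) hij
    rw [act_siegel (Q_e j) (by simp [hij.symm]), act_siegel (Q_e j) (by simp [hij.symm])] at h
    simp [hij, hij.symm] at h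
    have h1 := hH.coeff_apart_mem hn hσ hij
    have h2 := hH.coeff_apart_mem hn hσ hij.symm
    convert neg_mem (sub_mem h (sub_mem h1 h2)) using 1
    ring
  obtain ⟨m, hmi, hmj⟩ := exists_apart hn i j
  rw [← sub_add_sub_cancel _ (act σ (e m) (hb m))]
  exact add_mem (key hmi.symm) (key hmj)

theorem coeff_zero_mem (hH : IsENormal H) (hn : 3 ≤ n) {σ : orthogonal n R} (hσ : σ ∈ H)
    (j : Hb n) : act σ eZero (hb j) ∈ (hH.level hn).I := by
  obtain ⟨i, hij, -⟩ := exists_apart hn j j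
  -- The conjugating matrix maps `e i` to `e i - eZero - e i.swap` and fixes `e j.swap`.
  have h := hH.conj_coeff_apart_mem hn hσ (siegel_e_eZero_mem_elementary i.swap 1) hij
  rw [act_siegel (Q_e _) (by simp), act_siegel (Q_e _) (by simp)] at h
  simp [hij] at h
  have h1 := hH.coeff_apart_mem hn hσ hij
  have h2 := hH.coeff_apart_mem hn hσ hij.swap_left
  convert sub_mem (sub_mem h1 h2) h using 1
  ring

/-- Modulo `I`, all diagonal coefficients `σ_{ii}` with `i ∈ Θ_hb` agree, and their square is `1`
since `B(σ e_i, σ e_{-i}) = 1`. -/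
theorem one_sub_coeff_mul_coeff_mem (hH : IsENormal H) (hn : 3 ≤ n) {σ : orthogonal n R}
    (hσ : σ ∈ H) (i j : Hb n) :
    1 - act σ (e i) (hb i) * act σ (e j) (hb j) ∈ (hH.level hn).I := by
  set L := (hH.level hn).I with hL
  have h1 := polarForm_act σ (e i) (e i.swap)
  rw [polarForm_e_left, e_apply_self, polarForm,
    ← Finset.add_sum_erase _ _ (Finset.mem_univ i)] at h1
  have h2 : ∑ k ∈ Finset.univ.erase i, act σ (e i) (hb k) * act σ (e i.swap) (hb k.swap) ∈ L :=
    sum_mem fun k hk => L.mul_mem_right _ (hH.coeff_mem hn hσ (Finset.ne_of_mem_erase hk).symm)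
  have h3 : 2 * act σ (e i.swap) zero ∈ L := by
    have h : 2 * act σ (e i.swap) zero = act σ⁻¹ eZero (hb i) := by
      rw [← polarForm_eZero_left, ← polarForm_act σ⁻¹ eZero, act_inv_act, polarForm_e_right,
        Sum.swap_swap]
    rw [h]
    exact hH.coeff_zero_mem hn (inv_mem hσ) i
  have h4 := hH.coeff_sub_coeff_mem hn hσ i.swap j
  have h5 : 1 - act σ (e i) (hb i) * act σ (e j) (hb j) =
      act σ (e i) (hb i) * (act σ (e i.swap) (hb i.swap) - act σ (e j) (hb j)) +
      ∑ k ∈ Finset.univ.erase i, act σ (e i) (hb k) * act σ (e i.swap) (hb k.swap) +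
      act σ (e i) zero * (2 * act σ (e i.swap) zero) := by
    linear_combination -h1
  rw [h5]
  exact add_mem (add_mem (L.mul_mem_left _ h4) h2) (L.mul_mem_left _ h3)

/-- For the stabilizing element `τ` of `u = σ e_i`, the coordinate with index `0` of
`σ⁻¹ τ σ e_{-b}` belongs to `J` by `siegel_mul_inv_mem`. Modulo `I` it equals
`-σ_{ii} σ_{-b,-b} (σ⁻¹)_{0c}`, and `σ_{ii} σ_{-b,-b}` is `1` modulo `I`. -/
theorem coeff_row_zero_inv_mem (hH : IsENormal H) (hn : 3 ≤ n) {σ : orthogonal n R} (hσ : σ ∈ H)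
    (c : Hb n) : act σ⁻¹ (e c) zero ∈ (hH.level hn).J := by
  obtain ⟨b, hbc, -⟩ := exists_apart hn c c
  obtain ⟨i, hib, hic⟩ := exists_apart hn b c
  set L := hH.level hn with hL
  set u := act σ (e i) with hu
  set v := act σ (e b.swap) with hv
  have hzE : siegel (e i) (e b.swap : Theta n → R) ∈ elementary n R := by
    simpa using siegel_e_e_mem_elementary hib.swap_right (1 : R)
  have h1 := hH.siegel_mul_inv_mem hσ (stabilizing_mem_elementary hib hic hbc u)
    (act_stabilizing_self hib hic hbc u) hzE
  have hub : u (hb b.swap) ∈ L.I := hH.coeff_apart_mem hn hσ hib.swap_right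
  have huc : u (hb c.swap) ∈ L.I := hH.coeff_apart_mem hn hσ hic.swap_right
  -- The second factor of the stabilizing element lies in `H`, so modulo `H` only the first factor
  -- matters for its action on the transformation along `e i`.
  have h2 : siegel (e i.swap) (tangent u b c) ∈ H :=
    ((hH.isAbove_level hn).mem_siegelSub_e_of_small (by simp [hib.symm, hic.symm])
      (add_mem (smul_mem_smallVectors huc _) (smul_mem_smallVectors (neg_mem hub) _))).2
  have h3 := hH _ (siegel_e_e_mem_elementary hbc (u (hb i))) _ (hH.commutator_mem' h2 hzE)
  have h4 : act (siegel (e b) (u (hb i) • e c)) (e b.swap : Theta n → R) =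
      e b.swap - u (hb i) • e c := by
    rw [act_stabilizing_left hbc]
    simp [hbc]
  have h5 : act (siegel (e b) (u (hb i) • e c)) (e i : Theta n → R) = e i :=
    act_siegel_of_orthogonal (by simp [hib.symm]) (by simp [hic.symm])
  have h6 := siegel_conj (siegel (e b : Theta n → R) (u (hb i) • e c)) (e i) (e b.swap)
  rw [h4, h5] at h6
  set h := σ⁻¹ * stabilizing u i b c * σ with hh
  have hfix : act h (e i) = e i := by
    rw [hh, act_mul, act_mul, ← hu, act_stabilizing_self hib hic hbc, hu, act_inv_act]
  have h7 : act h (e b.swap) - (e b.swap - u (hb i) • e c) ∈ siegelSub (e i) H := by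
    have h70 : polarForm (e i : Theta n → R) (act h (e b.swap)) = 0 := by
      rw [← hfix, polarForm_act]
      simp [hib]
    have h71 : polarForm (e i : Theta n → R) (e b.swap - u (hb i) • e c) = 0 := by simp [hib, hic]
    refine ⟨by rw [polarForm_sub_right, h70, h71, sub_zero], ?_⟩
    rw [sub_eq_add_neg, siegel_add _ h70 (by rw [polarForm_neg_right, h71, neg_zero]),
      siegel_neg _ h71, ← h6]
    convert mul_mem h1 h3 using 1
    rw [stabilizing]
    group
  have h8 := hH.apply_mem_level_J hn h7
  have h9 : act h (e b.swap) = e b.swap + polarForm (tangent u b c) v • act σ⁻¹ (e i.swap) -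
      v (hb i) • act σ⁻¹ (tangent u b c) + (u (hb i) * v (hb c.swap)) • act σ⁻¹ (e b) -
      (u (hb i) * v (hb b.swap)) • act σ⁻¹ (e c) := by
    rw [hh, act_mul, act_mul, ← hv, act_stabilizing hib hic hbc]
    simp only [map_add, map_sub, map_smul]
    rw [hv, act_inv_act]
  have hvi : v (hb i) ∈ L.I := hH.coeff_apart_mem hn hσ hib.symm.swap_left
  have hvc : v (hb c.swap) ∈ L.I := hH.coeff_apart_mem hn hσ hbc.swap_left.swap_right
  have htv : polarForm (tangent u b c) v ∈ L.I := by
    simp only [tangent, polarForm_add_left, polarForm_smul_left, polarForm_e_left]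
    exact add_mem (L.I.mul_mem_right _ huc) (L.I.mul_mem_right _ (neg_mem hub))
  have hunit : 1 - u (hb i) * v (hb b.swap) ∈ L.I :=
    hH.one_sub_coeff_mul_coeff_mem hn hσ i b.swap
  rw [h9] at h8
  simp only [Pi.add_apply, Pi.sub_apply, Pi.smul_apply, smul_eq_mul, e_apply_zero] at h8
  have h10 : act σ⁻¹ (e c) zero =
      (1 - u (hb i) * v (hb b.swap)) * act σ⁻¹ (e c) zero -
      (0 + polarForm (tangent u b c) v * act σ⁻¹ (e i.swap) zero -
        v (hb i) * act σ⁻¹ (tangent u b c) zero +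
        u (hb i) * v (hb c.swap) * act σ⁻¹ (e b) zero -
        u (hb i) * v (hb b.swap) * act σ⁻¹ (e c) zero - (0 - u (hb i) * 0)) +
      polarForm (tangent u b c) v * act σ⁻¹ (e i.swap) zero -
      v (hb i) * act σ⁻¹ (tangent u b c) zero +
      u (hb i) * v (hb c.swap) * act σ⁻¹ (e b) zero := by
    ring
  rw [h10]
  refine add_mem (sub_mem (add_mem (sub_mem ?_ h8) ?_) ?_) ?_
  · exact L.le (L.I.mul_mem_right _ hunit)
  · exact L.le (L.I.mul_mem_right _ htv)
  · exact L.le (L.I.mul_mem_right _ hvi)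
  · exact L.le (L.I.mul_mem_right _ (L.I.mul_mem_left _ hvc))

theorem coeff_row_zero_mem (hH : IsENormal H) (hn : 3 ≤ n) {σ : orthogonal n R} (hσ : σ ∈ H)
    (c : Hb n) : act σ (e c) zero ∈ (hH.level hn).J := by
  simpa using hH.coeff_row_zero_inv_mem hn (inv_mem hσ) c

theorem coeff_zero_zero_sub_mem (hH : IsENormal H) (hn : 3 ≤ n) {σ : orthogonal n R}
    (hσ : σ ∈ H) (i : Hb n) :
    act σ eZero zero - act σ (e i) (hb i) ∈ (hH.level hn).J := by
  set L := hH.level hn with hL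
  have hε : siegel (e i.swap) (eZero : Theta n → R) ∈ elementary n R := by
    simpa using siegel_e_eZero_mem_elementary i.swap (1 : R)
  -- The coefficient with index `(0, i)` of `ε⁻¹ σ ε`, for `ε = siegel (e i.swap) eZero`, involves
  -- both `σ_{00}` and `σ_{ii}`.
  have h := hH.coeff_row_zero_mem hn (hH _ (inv_mem hε) σ hσ) i
  rw [inv_inv, act_mul, act_mul, ← siegel_neg _ (by simp), act_siegel (Q_e _) (by simp),
    act_siegel (Q_e _) (by simp)] at h
  simp at h
  have h1 := hH.coeff_row_zero_mem hn hσ i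
  have h2 := hH.coeff_row_zero_mem hn hσ i.swap
  have h3 := L.le (hH.coeff_zero_mem hn hσ i)
  have h4 : act σ (e i.swap) (hb i) ∈ L.J := L.le (hH.coeff_mem hn hσ (swap_ne i))
  convert sub_mem (sub_mem (sub_mem (sub_mem h1 h2) h3) h4) h using 1
  ring

/-- An element of `H` is a scalar matrix up to a matrix which is small with respect to the level
of `H`. -/
theorem le_fullCongruence_level (hH : IsENormal H) (hn : 3 ≤ n) :
    H ≤ fullCongruence n (hH.level hn) := by
  intro σ hσ ε hε
  have i : Hb n := Sum.inl ⟨0, by omega⟩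
  set d := act σ (e i) (hb i) with hd
  have hM : IsSmall (hH.level hn) (σ.1.1 - d • 1) := by
    refine ⟨fun j k => ?_, fun k => ?_⟩
    · rcases k with ⟨⟩ | k
      · simpa [act_eZero_apply] using hH.coeff_zero_mem hn hσ j
      · by_cases hjk : j = k
        · rw [hjk]
          simpa [act_e_apply, hd] using hH.coeff_sub_coeff_mem hn hσ k i
        · simpa [act_e_apply, hjk] using hH.coeff_mem hn hσ (Ne.symm hjk)
    · rcases k with ⟨⟩ | k
      · simpa [act_eZero_apply] using hH.coeff_zero_zero_sub_mem hn hσ i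
      · simpa [act_e_apply] using hH.coeff_row_zero_mem hn hσ k
  change IsSmall _ _
  have h : (σ * ε * σ⁻¹ * ε⁻¹).1.1 - 1 =
      ((σ.1.1 - d • 1) * ε.1.1 + -(ε.1.1 * (σ.1.1 - d • 1))) * (σ⁻¹ * ε⁻¹).1.1 := by
    have h1 : (ε.1.1 * σ.1.1) * (σ⁻¹ * ε⁻¹).1.1 = 1 := by
      have : ε * σ * (σ⁻¹ * ε⁻¹) = 1 := by group
      exact congrArg (fun g : orthogonal n R => g.1.1) this
    have h2 : (σ * ε * σ⁻¹ * ε⁻¹).1.1 = σ.1.1 * ε.1.1 * (σ⁻¹ * ε⁻¹).1.1 := by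
      have : σ * ε * σ⁻¹ * ε⁻¹ = σ * ε * (σ⁻¹ * ε⁻¹) := by group
      exact congrArg (fun g : orthogonal n R => g.1.1) this
    calc (σ * ε * σ⁻¹ * ε⁻¹).1.1 - 1 =
          σ.1.1 * ε.1.1 * (σ⁻¹ * ε⁻¹).1.1 - ε.1.1 * σ.1.1 * (σ⁻¹ * ε⁻¹).1.1 := by rw [h1, h2]
      _ = _ := by
        rw [← sub_mul]
        congr 1
        rw [mul_sub, sub_mul, smul_mul_assoc, mul_smul_comm, one_mul, mul_one]
        abel
  rw [h]
  exact ((hM.mul_right _).add (hM.mul_left ε).neg).mul_right _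

end IsENormal

end OddOrthogonal

theorem mainTheorem3 {R : Type*} [CommRing R] (n : ℕ) (hn : 3 ≤ n)
    (H : Subgroup (OddOrthogonal.orthogonal n R)) :
    OddOrthogonal.elementary n R ≤
        Subgroup.normalizer (H : Set (OddOrthogonal.orthogonal n R)) ↔
      ∃ P : OddOrthogonal.AdmissiblePair R,
        OddOrthogonal.relElementary n P ≤ H ∧ H ≤ OddOrthogonal.fullCongruence n P := by
  constructor
  · intro h
    have hH : OddOrthogonal.IsENormal H := fun ε hε σ hσ =>
      (Subgroup.mem_normalizer_iff.1 (h hε) σ).1 hσ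
    exact ⟨hH.level hn, (hH.isAbove_level hn).relElementary_le, hH.le_fullCongruence_level hn⟩
  · rintro ⟨P, hP, hH⟩
    have key : ∀ ε ∈ OddOrthogonal.elementary n R, ∀ σ ∈ H, ε * σ * ε⁻¹ ∈ H := by
      intro ε hε σ hσ
      have h := hP ((OddOrthogonal.isAbove_relElementary P).commutator_fullCongruence_mem hn
        (hH hσ) hε)
      simpa [mul_assoc] using mul_mem (inv_mem h) hσ
    intro ε hε
    refine Subgroup.mem_normalizer_iff.2 fun σ => ⟨key ε hε σ, fun hσ => ?_⟩
    simpa [mul_assoc] using key ε⁻¹ (inv_mem hε) _ hσ
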